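/- **Setting.** An election consists of a set $C$ of $m$ candidates and an ordered list $V=(v_1,\dots,v_n)$ of voters, each with a linear order $\succ_v$ over $C$; $\mathrm{pos}_v(c)\in\{1,\dots,m\}$ is the position of $c$ in the order of $v$. The election is *single-crossing* if for all $a,b\in C$ with $a\succ_{v_1}b$ there is $t\in\{1,\dots,n\}$ with $\{i: a\succ_{v_i} b\}=\{1,\dots,t\}$, and *narcissistic* if every candidate is ranked first by at least one voter. A *dissatisfaction function* for $m$ candidates is a nondecreasing $\alpha:\{1,\dots,m\}\to\mathbb N$ with $\alpha(1)=0$. For $1\le k\le m$, a *$k$-Monroe assignment* is a map $\Phi:V\to C$ with exactly $k$ candidates in its image, each of which is assigned to at least $\lfloor n/k\rfloor$ and at most $\lceil n/k\rceil$ voters. It is *optimal under $\alpha$-$\ell_\infty$-Monroe* if it minimizes $\max_{v\in V}\alpha(\mathrm{pos}_v(\Phi(v)))$ among all $k$-Monroe assignments. It has the *contiguous blocks property* if the voters assigned to each candidate are consecutive in $V$. Running times are numbers of steps of a random access machine in which additions, truncated subtractions, comparisons and (indirect) memory accesses take one step each, and in which memory that does not hold the input is uninitialized. **Theorem.** (i)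 There is an algorithm that, given a single-crossing narcissistic election with $n$ voters and $m$ candidates, an integer $k$ with $1\le k\le m$, and the table of values $\alpha(1),\dots,\alpha(m)$ of a dissatisfaction function for $m$ candidates, finds in time $O(nm^2k)$ an optimal $k$-Monroe assignment under $\alpha$-$\ell_\infty$-Monroe, and one with the contiguous blocks property. (ii) Let $(\alpha^m)_{m\ge1}$ be a polynomial-time computable family of dissatisfaction functions: some program computes $\alpha^m(i)$ from $m$ and $i\in\{1,\dots,m\}$ within $T(m)$ steps, where $T$ is a polynomial with coefficients in $\mathbb N$. Then there is a polynomial-time algorithm that, given a single-crossing narcissistic election with $n$ voters and $m$ candidates and an integer $k$ with $1\le k\le m$, finds an optimal $k$-Monroe assignment under $\alpha^m$-$\ell_\infty$-Monroe, and one with the contiguous blocks property; its running time is $O(nm^2k + m\,T(m))$. -/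

import Mathlib

/-! ### Elections -/

/-- An election with the ordered list of voters `0, …, n - 1` and the candidates `0, …, m - 1`.
The preference order of voter `v` is given as a ranking, a bijection from ranks to candidates:
`ranking v r` is the candidate that has exactly `r` candidates above it. -/
structure Election (n m : ℕ) where
  ranking : Fin n → Fin m ≃ Fin m

namespace Election

variable {n m : ℕ}

/-- The position (counted from `1`) of candidate `c` in the preference order of voter `v`. -/
def pos (E : Election n m) (v : Fin n) (c : Fin m) : ℕ :=
  ((E.ranking v).symm c : ℕ) + 1

/-- Voter `v` prefers `a` to `b`. -/
def Prefers (E : Election n m) (v : Fin n) (a b : Fin m) : Prop :=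
  E.pos v a < E.pos v b

/-- For each pair of candidates `a`, `b` such that the first voter prefers `a` to `b`, the voters
who prefer `a` to `b` are exactly the first `t` voters, for some `1 ≤ t ≤ n`. -/
def SingleCrossing (E : Election n m) : Prop :=
  ∀ (hn : 0 < n) (a b : Fin m), E.Prefers ⟨0, hn⟩ a b →
    ∃ t : ℕ, 1 ≤ t ∧ t ≤ n ∧ ∀ v : Fin n, E.Prefers v a b ↔ (v : ℕ) < t

/-- Every candidate is ranked first by at least one voter. -/
def Narcissistic (E : Election n m) : Prop :=
  ∀ c : Fin m, ∃ v : Fin n, E.pos v c = 1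

/-- The egalitarian aggregate `ℓ_∞(Φ) = max_v α(pos_v(Φ(v)))`. -/
def linfty (E : Election n m) (α : ℕ → ℕ) (Φ : Fin n → Fin m) : ℕ :=
  Finset.univ.sup fun v => α (E.pos v (Φ v))

end Election

/-- Dissatisfaction functions `[m] → ℕ`, as functions on `ℕ` of which only the values on
`{1, …, m}` are relevant. -/
structure IsDissatisfaction (m : ℕ) (α : ℕ → ℕ) : Prop where
  one : α 1 = 0
  mono : MonotoneOn α (Set.Icc 1 m)

/-- A `k`-CC-assignment function uses at most `k` candidates. -/
def IsCCAssignment {n m : ℕ} (k : ℕ) (Φ : Fin n → Fin m) : Prop :=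
  (Finset.univ.image Φ).card ≤ k

/-- A `k`-Monroe-assignment function: exactly `k` candidates are used, each of them for at least
`⌊n / k⌋` and at most `⌈n / k⌉` voters. -/
structure IsMonroeAssignment {n m : ℕ} (k : ℕ) (Φ : Fin n → Fin m) : Prop where
  isCC : IsCCAssignment k Φ
  card_image : (Finset.univ.image Φ).card = k
  card_fiber : ∀ c : Fin m, (Finset.univ.filter fun v => Φ v = c).card = 0 ∨
    (n / k ≤ (Finset.univ.filter fun v => Φ v = c).card ∧
      (Finset.univ.filter fun v => Φ v = c).card ≤ n ⌈/⌉ k)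

/-- `Φ` is an optimal `k`-Monroe assignment for `E` under `α`-`ℓ_∞`-Monroe. -/
def Election.IsOptimalMonroe {n m : ℕ} (E : Election n m) (α : ℕ → ℕ) (k : ℕ)
    (Φ : Fin n → Fin m) : Prop :=
  IsMonroeAssignment k Φ ∧
    ∀ Ψ : Fin n → Fin m, IsMonroeAssignment k Ψ → E.linfty α Φ ≤ E.linfty α Ψ

/-- The voters represented by any given candidate are consecutive. -/
def HasContiguousBlocks {n m : ℕ} (Φ : Fin n → Fin m) : Prop :=
  ∀ u v w : Fin n, u ≤ v → v ≤ w → Φ u = Φ w → Φ v = Φ u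

/-! ### Random access machines

Structured programs for a random access machine with unit-cost steps. A program uses finitely many
registers and finitely many unbounded arrays of natural numbers, with indirect addressing. The only
arithmetic is addition, truncated subtraction and comparison (there is no multiplication), so that
a number grows by at most one bit per step and polynomially many steps are polynomial time. -/

/-- A memory state: `reg x` is the content of register `x`, and `arr a i` is the content of cell
`i` of array `a`. -/
structure RAMState where
  reg : ℕ → ℕ
  arr : ℕ → ℕ → ℕ

/-- Write `v` to register `x`. -/
def RAMState.setReg (s : RAMState) (x v : ℕ) : RAMState :=
  { s with reg := Function.update s.reg x v }

/-- Write `v` to cell `i` of array `a`. -/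
def RAMState.setArr (s : RAMState) (a i v : ℕ) : RAMState :=
  { s with arr := Function.update s.arr a (Function.update (s.arr a) i v) }

/-- Programs. Here `x`, `y`, `z` are names of registers, `a` is the name of an array, and `c` is a
numeral. -/
inductive RAMProg : Type
  /-- do nothing -/
  | skip : RAMProg
  /-- `x := c` -/
  | const (x c : ℕ) : RAMProg
  /-- `x := y` -/
  | copy (x y : ℕ) : RAMProg
  /-- `x := y + z` -/
  | add (x y z : ℕ) : RAMProg
  /-- `x := y - z`, truncated at zero -/
  | sub (x y z : ℕ) : RAMProg
  /-- `x := a[y]` -/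
  | load (x a y : ℕ) : RAMProg
  /-- `a[x] := y` -/
  | store (a x y : ℕ) : RAMProg
  /-- sequential composition -/
  | seq (p q : RAMProg) : RAMProg
  /-- `if x < y then p else q` -/
  | ifLt (x y : ℕ) (p q : RAMProg) : RAMProg
  /-- `while x < y do p` -/
  | whileLt (x y : ℕ) (p : RAMProg) : RAMProg

/-- `p.Runs s t s'`: started in the memory state `s`, the program `p` halts in the memory state
`s'` after exactly `t` steps. Every elementary instruction and every test is one step. -/
inductive RAMProg.Runs : RAMProg → RAMState → ℕ → RAMState → Prop
  | skip (s : RAMState) : Runs .skip s 1 s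
  | const (s : RAMState) (x c : ℕ) : Runs (.const x c) s 1 (s.setReg x c)
  | copy (s : RAMState) (x y : ℕ) : Runs (.copy x y) s 1 (s.setReg x (s.reg y))
  | add (s : RAMState) (x y z : ℕ) : Runs (.add x y z) s 1 (s.setReg x (s.reg y + s.reg z))
  | sub (s : RAMState) (x y z : ℕ) : Runs (.sub x y z) s 1 (s.setReg x (s.reg y - s.reg z))
  | load (s : RAMState) (x a y : ℕ) : Runs (.load x a y) s 1 (s.setReg x (s.arr a (s.reg y)))
  | store (s : RAMState) (a x y : ℕ) :
      Runs (.store a x y) s 1 (s.setArr a (s.reg x) (s.reg y))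
  | seq {p q : RAMProg} {s s' s'' : RAMState} {t t' : ℕ} :
      Runs p s t s' → Runs q s' t' s'' → Runs (.seq p q) s (t + t') s''
  | ifLt_true {x y : ℕ} {p q : RAMProg} {s s' : RAMState} {t : ℕ} :
      s.reg x < s.reg y → Runs p s t s' → Runs (.ifLt x y p q) s (t + 1) s'
  | ifLt_false {x y : ℕ} {p q : RAMProg} {s s' : RAMState} {t : ℕ} :
      ¬ s.reg x < s.reg y → Runs q s t s' → Runs (.ifLt x y p q) s (t + 1) s'
  | while_true {x y : ℕ} {p : RAMProg} {s s' s'' : RAMState} {t t' : ℕ} :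
      s.reg x < s.reg y → Runs p s t s' → Runs (.whileLt x y p) s' t' s'' →
        Runs (.whileLt x y p) s (t + t' + 1) s''
  | while_false {x y : ℕ} {p : RAMProg} {s : RAMState} :
      ¬ s.reg x < s.reg y → Runs (.whileLt x y p) s 1 s

/-! ### Inputs and outputs

Memory that does not hold the input is uninitialized: programs, those that compute dissatisfaction
functions and those that find assignments alike, have to work whatever it contains. -/

/-- The program `p` computes the family `α` in time `T`: given `m` in register `0` and `i ∈ [m]` in
register `1`, it halts within `T m` steps with `α m i` in register `0`. -/
def RAMProg.ComputesFamily (p : RAMProg) (α : ℕ → ℕ → ℕ) (T : ℕ → ℕ) : Prop :=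
  ∀ m i : ℕ, 1 ≤ i → i ≤ m → ∀ s : RAMState, s.reg 0 = m → s.reg 1 = i →
    ∃ (t : ℕ) (s' : RAMState), p.Runs s t s' ∧ t ≤ T m ∧ s'.reg 0 = α m i

/-- The state `s` holds the election `E` and the parliament size `k`: the registers `0`, `1`, `2`
hold `n`, `m`, `k`, and array `0` lists the preference orders of the voters one after the other,
each from the most desirable to the least desirable candidate. -/
def RAMState.HoldsInput {n m : ℕ} (s : RAMState) (E : Election n m) (k : ℕ) : Prop :=
  s.reg 0 = n ∧ s.reg 1 = m ∧ s.reg 2 = k ∧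
    ∀ (v : Fin n) (r : Fin m), s.arr 0 ((v : ℕ) * m + (r : ℕ)) = (E.ranking v r : ℕ)

/-- Array `1` of the state `s` holds the values `α 1, …, α m`. -/
def RAMState.HoldsTable (s : RAMState) (m : ℕ) (α : ℕ → ℕ) : Prop :=
  ∀ i : ℕ, 1 ≤ i → i ≤ m → s.arr 1 i = α i

/-- Array `2` of the state `s` holds the assignment `Φ`. -/
def RAMState.HoldsAssignment {n m : ℕ} (s : RAMState) (Φ : Fin n → Fin m) : Prop :=
  ∀ v : Fin n, s.arr 2 (v : ℕ) = (Φ v : ℕ)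

/-- Started in the state `s`, the program `p` finds within `B` steps an optimal `k`-Monroe
assignment for `E` under `α`-`ℓ_∞`-Monroe, and the one it finds has the contiguous blocks
property. -/
def RAMProg.FindsOptimalMonroe {n m : ℕ} (p : RAMProg) (s : RAMState) (B : ℕ)
    (E : Election n m) (α : ℕ → ℕ) (k : ℕ) : Prop :=
  ∃ (t : ℕ) (s' : RAMState) (Φ : Fin n → Fin m), p.Runs s t s' ∧ t ≤ B ∧
    s'.HoldsAssignment Φ ∧ E.IsOptimalMonroe α k Φ ∧ HasContiguousBlocks Φ

/-
As `α` is nondecreasing, it suffices to minimize the worst position: such an assignment is optimal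
for every `α` at once, and the algorithm never looks at `α`.

List the candidates in the order of the first voter. A single-crossing narcissistic election is
single-peaked on this axis, and its voters are sorted by their favourite candidates. Hence
exchanging the candidates of two voters whose assignment runs against the axis does not increase
the worst position, and sorting an optimal assignment along the axis makes each candidate's voters a
block of consecutive voters, with the same block sizes. What is left is a dynamic program over the
number of candidates, the number of blocks and the number of voters dealt with. Since the position
of a candidate, seen along the list of voters, first falls and then rises, a block attains its worst
position at one of its ends and each table entry takes constant time.
-/

namespace Election

variable {n m : ℕ} {E : Election n m}

theorem pos_injective (E : Election n m) (v : Fin n) : Function.Injective (E.pos v) := by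
  intro a b h
  simpa [pos, Fin.val_inj] using h

theorem pos_ranking (E : Election n m) (v : Fin n) (r : Fin m) :
    E.pos v (E.ranking v r) = r + 1 := by
  simp [pos]

theorem pos_pos (E : Election n m) (v : Fin n) (c : Fin m) : 0 < E.pos v c :=
  Nat.succ_pos _

theorem pos_le (E : Election n m) (v : Fin n) (c : Fin m) : E.pos v c ≤ m :=
  ((E.ranking v).symm c).isLt

theorem card_pos_lt_add_one (E : Election n m) (v : Fin n) (c : Fin m) :
    (Finset.univ.filter fun x => E.pos v x < E.pos v c).card + 1 = E.pos v c := by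
  have h : (Finset.univ.filter fun x => E.pos v x < E.pos v c) =
      (Finset.Iio ((E.ranking v).symm c)).map (E.ranking v).toEmbedding := by
    ext x
    simp [pos, Finset.mem_map_equiv]
  rw [h, Finset.card_map, Fin.card_Iio, pos]

theorem exists_overtaking {u v : Fin n} {c : Fin m} (h : E.pos u c < E.pos v c) :
    ∃ x, E.pos v x < E.pos v c ∧ E.pos u c < E.pos u x := by
  have hcard : (Finset.univ.filter fun x => E.pos u x < E.pos u c).card <
      (Finset.univ.filter fun x => E.pos v x < E.pos v c).card := by
    have hu := E.card_pos_lt_add_one u c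
    have hv := E.card_pos_lt_add_one v c
    omega
  obtain ⟨x, hx, hx'⟩ := Finset.exists_mem_notMem_of_card_lt_card hcard
  simp only [Finset.mem_filter, Finset.mem_univ, true_and, not_lt] at hx hx'
  exact ⟨x, hx, hx'.lt_of_ne ((E.pos_injective u).ne fun he => hx.ne (by rw [he]))⟩

theorem Narcissistic.le (hN : E.Narcissistic) : m ≤ n := by
  choose top htop using hN
  have hinj : Function.Injective top := fun a b h =>
    E.pos_injective (top b) ((h ▸ htop a).trans (htop b).symm)
  simpa using Fintype.card_le_of_injective top hinj

/-- The position in the order of voter `v` of the `p`-th candidate of the axis, which is the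
preference order of the first voter. -/
def axisPos (E : Election n m) (hn : 0 < n) (v : Fin n) (p : Fin m) : ℕ :=
  E.pos v (E.ranking ⟨0, hn⟩ p)

variable {hn : 0 < n}

theorem axisPos_injective (v : Fin n) : Function.Injective (E.axisPos hn v) :=
  (E.pos_injective v).comp (E.ranking ⟨0, hn⟩).injective

theorem exists_axisPos_overtaking {u v : Fin n} {p : Fin m}
    (h : E.axisPos hn u p < E.axisPos hn v p) :
    ∃ x, E.axisPos hn v x < E.axisPos hn v p ∧ E.axisPos hn u p < E.axisPos hn u x := by
  obtain ⟨x, hx⟩ := exists_overtaking h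
  exact ⟨(E.ranking ⟨0, hn⟩).symm x, by simpa [axisPos] using hx⟩

namespace SingleCrossing

theorem axisPos_lt_of_le (hE : E.SingleCrossing) {p p' : Fin m} (hp : p < p') {u v : Fin n}
    (huv : u ≤ v) (h : E.axisPos hn v p < E.axisPos hn v p') :
    E.axisPos hn u p < E.axisPos hn u p' := by
  obtain ⟨t, -, -, ht⟩ := hE hn (E.ranking ⟨0, hn⟩ p) (E.ranking ⟨0, hn⟩ p')
    (by simpa [Prefers, pos_ranking] using hp)
  exact (ht u).2 (lt_of_le_of_lt huv ((ht v).1 h))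

-- A voter `z` who ranks `p'` first prefers `p'` to both `p` and `p''`; single-crossing carries one
-- of these two comparisons over to `v`.
theorem single_peaked (hE : E.SingleCrossing) (hN : E.Narcissistic) {p p' p'' : Fin m}
    (hp : p < p') (hp' : p' < p'') (v : Fin n) (h : E.axisPos hn v p < E.axisPos hn v p') :
    E.axisPos hn v p' < E.axisPos hn v p'' := by
  obtain ⟨z, hz⟩ := hN (E.ranking ⟨0, hn⟩ p')
  have top {x : Fin m} (hx : p' ≠ x) : E.axisPos hn z p' < E.axisPos hn z x :=
    lt_of_le_of_ne (hz.le.trans (E.pos_pos _ _)) ((axisPos_injective z).ne hx)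
  rcases le_total v z with hvz | hzv
  · exact hE.axisPos_lt_of_le hp' hvz (top hp'.ne)
  · exact absurd (hE.axisPos_lt_of_le hp hzv h) (top hp.ne').not_gt

theorem exists_gt_axisPos_lt (hE : E.SingleCrossing) {u v : Fin n} (huv : u ≤ v) {p : Fin m}
    (h : E.axisPos hn u p < E.axisPos hn v p) :
    ∃ x, p < x ∧ E.axisPos hn v x < E.axisPos hn v p := by
  obtain ⟨x, hx, hx'⟩ := exists_axisPos_overtaking h
  refine ⟨x, lt_of_not_ge fun hxp => ?_, hx⟩
  rcases hxp.lt_or_eq with hlt | rfl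
  · exact hx'.not_gt (hE.axisPos_lt_of_le hlt huv hx)
  · exact hx.false

theorem exists_lt_axisPos_lt (hE : E.SingleCrossing) {u v : Fin n} (huv : u ≤ v) {p : Fin m}
    (h : E.axisPos hn v p < E.axisPos hn u p) :
    ∃ x, x < p ∧ E.axisPos hn u x < E.axisPos hn u p := by
  obtain ⟨x, hx, hx'⟩ := exists_axisPos_overtaking h
  refine ⟨x, lt_of_not_ge fun hxp => ?_, hx⟩
  rcases hxp.lt_or_eq with hlt | rfl
  · exact hx.not_gt (hE.axisPos_lt_of_le hlt huv hx')
  · exact hx.false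

theorem axisPos_le_max (hE : E.SingleCrossing) (hN : E.Narcissistic) {u v x : Fin n} (huv : u ≤ v)
    (hvx : v ≤ x) (p : Fin m) :
    E.axisPos hn v p ≤ max (E.axisPos hn u p) (E.axisPos hn x p) := by
  by_contra! h
  rw [max_lt_iff] at h
  obtain ⟨y, hy, hy'⟩ := hE.exists_gt_axisPos_lt huv h.1
  obtain ⟨z, hz, hz'⟩ := hE.exists_lt_axisPos_lt hvx h.2
  exact hy'.not_gt (hE.single_peaked hN hz hy v hz')

theorem axisPos_le_max_left (hE : E.SingleCrossing) (hN : E.Narcissistic) {u v : Fin n}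
    (huv : u ≤ v) {p p' : Fin m} (hp : p ≤ p') :
    E.axisPos hn u p ≤ max (E.axisPos hn u p') (E.axisPos hn v p) := by
  rcases hp.eq_or_lt with rfl | hp
  · exact le_max_left _ _
  by_contra! h
  rw [max_lt_iff] at h
  obtain ⟨z, hz, hz'⟩ := hE.exists_lt_axisPos_lt huv h.2
  exact h.1.not_gt (hE.single_peaked hN hz hp u hz')

theorem axisPos_le_max_right (hE : E.SingleCrossing) (hN : E.Narcissistic) {u v : Fin n}
    (huv : u ≤ v) {p p' : Fin m} (hp : p ≤ p') :
    E.axisPos hn v p' ≤ max (E.axisPos hn v p) (E.axisPos hn u p') := by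
  rcases hp.eq_or_lt with rfl | hp
  · exact le_max_left _ _
  by_contra! h
  rw [max_lt_iff] at h
  obtain ⟨y, hy, hy'⟩ := hE.exists_gt_axisPos_lt huv h.2
  exact hy'.not_gt (hE.single_peaked hN hp hy v h.1)

end SingleCrossing

end Election

section Sorting

variable {n : ℕ} {β : Type*} [LinearOrder β] {g : Fin n → β} {p : β} {v : Fin n}

theorem exists_le_of_card_lt_le (h : (Finset.univ.filter fun u => g u < p).card ≤ v) :
    ∃ u ≤ v, p ≤ g u := by
  by_contra! hlt
  have hsub : Finset.Iic v ⊆ Finset.univ.filter fun u => g u < p := fun u hu =>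
    Finset.mem_filter.2 ⟨Finset.mem_univ u, hlt u (Finset.mem_Iic.1 hu)⟩
  have hcard := Finset.card_le_card hsub
  rw [Fin.card_Iic] at hcard
  omega

theorem exists_ge_of_lt_card_le (h : v < (Finset.univ.filter fun u => g u ≤ p).card) :
    ∃ u ≥ v, g u ≤ p := by
  by_contra! hlt
  have hsub : (Finset.univ.filter fun u => g u ≤ p) ⊆ Finset.Iio v := fun u hu =>
    Finset.mem_Iio.2 (lt_of_not_ge fun hvu => (hlt u hvu).not_ge (Finset.mem_filter.1 hu).2)
  have hcard := Finset.card_le_card hsub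
  rw [Fin.card_Iio] at hcard
  omega

end Sorting

-- The hypotheses on `v` say that `v` gets `p` when the values of `g` are sorted.
theorem Election.SingleCrossing.axisPos_sort_le {n m : ℕ} {E : Election n m} {hn : 0 < n}
    (hE : E.SingleCrossing) (hN : E.Narcissistic) {g : Fin n → Fin m} {d : ℕ}
    (hd : ∀ u, E.axisPos hn u (g u) ≤ d) {p : Fin m} {v : Fin n}
    (hlt : (Finset.univ.filter fun u => g u < p).card ≤ v)
    (hle : v < (Finset.univ.filter fun u => g u ≤ p).card) : E.axisPos hn v p ≤ d := by
  obtain ⟨z, hz, hz'⟩ := Finset.exists_mem_notMem_of_card_lt_card (hlt.trans_lt hle)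
  simp only [Finset.mem_filter, Finset.mem_univ, true_and, not_lt] at hz hz'
  obtain rfl : g z = p := hz.antisymm hz'
  rcases le_total v z with hvz | hzv
  · obtain ⟨u, huv, hu⟩ := exists_le_of_card_lt_le hlt
    calc E.axisPos hn v (g z)
        ≤ max (E.axisPos hn u (g z)) (E.axisPos hn z (g z)) := hE.axisPos_le_max hN huv hvz _
      _ ≤ max (max (E.axisPos hn u (g u)) (E.axisPos hn z (g z))) (E.axisPos hn z (g z)) :=
        max_le_max_right _ (hE.axisPos_le_max_left hN (huv.trans hvz) hu)
      _ ≤ d := max_le (max_le (hd u) (hd z)) (hd z)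
  · obtain ⟨u, hvu, hu⟩ := exists_ge_of_lt_card_le hle
    calc E.axisPos hn v (g z)
        ≤ max (E.axisPos hn z (g z)) (E.axisPos hn u (g z)) := hE.axisPos_le_max hN hzv hvu _
      _ ≤ max (E.axisPos hn z (g z)) (max (E.axisPos hn u (g u)) (E.axisPos hn z (g z))) :=
        max_le_max_left _ (hE.axisPos_le_max_right hN (hzv.trans hvu) hu)
      _ ≤ d := max_le (hd z) (max_le (hd u) (hd z))

/-- The number of voters in the blocks of the first `c` candidates, for the block sizes `f`. -/
def blockStart (f : ℕ → ℕ) (c : ℕ) : ℕ :=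
  ∑ p ∈ Finset.range c, f p

/-- The number of nonempty blocks of the first `c` candidates, for the block sizes `f`. -/
def blockCount (f : ℕ → ℕ) (c : ℕ) : ℕ :=
  Nat.count (fun p => f p ≠ 0) c

section BlockSizes

variable {f f' : ℕ → ℕ} {c : ℕ}

@[simp]
theorem blockStart_zero (f : ℕ → ℕ) : blockStart f 0 = 0 :=
  rfl

theorem blockStart_succ (f : ℕ → ℕ) (c : ℕ) : blockStart f (c + 1) = blockStart f c + f c :=
  Finset.sum_range_succ f c

theorem blockStart_mono (f : ℕ → ℕ) : Monotone (blockStart f) := fun _ _ h =>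
  Finset.sum_le_sum_of_subset (Finset.range_mono h)

theorem blockStart_congr (h : ∀ p < c, f p = f' p) : blockStart f c = blockStart f' c :=
  Finset.sum_congr rfl fun p hp => h p (Finset.mem_range.1 hp)

theorem exists_block_of_lt_blockStart {v : ℕ} (h : v < blockStart f c) :
    ∃ p < c, blockStart f p ≤ v ∧ v < blockStart f (p + 1) := by
  induction c with
  | zero => simp at h
  | succ c ih =>
    rcases lt_or_ge v (blockStart f c) with hv | hv
    · obtain ⟨p, hp, hpv⟩ := ih hv
      exact ⟨p, hp.trans c.lt_succ_self, hpv⟩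
    · exact ⟨c, c.lt_succ_self, hv, h⟩

@[simp]
theorem blockCount_zero (f : ℕ → ℕ) : blockCount f 0 = 0 :=
  rfl

theorem blockCount_succ (f : ℕ → ℕ) (c : ℕ) :
    blockCount f (c + 1) = blockCount f c + if f c ≠ 0 then 1 else 0 :=
  Nat.count_succ _ c

theorem blockCount_congr (h : ∀ p < c, f p = f' p) : blockCount f c = blockCount f' c := by
  simp only [blockCount, Nat.count_eq_card_filter_range]
  exact congrArg Finset.card <| Finset.filter_congr fun p hp => by rw [h p (Finset.mem_range.1 hp)]

theorem blockCount_eq_card_fin (f : ℕ → ℕ) (m : ℕ) :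
    blockCount f m = (Finset.univ.filter fun p : Fin m => f p ≠ 0).card := by
  rw [blockCount, Nat.count_eq_card_filter_range, Finset.card_filter, Finset.card_filter,
    Finset.sum_range]

theorem blockStart_card_fiber {n : ℕ} (g : Fin n → ℕ) (c : ℕ) :
    blockStart (fun p => (Finset.univ.filter fun v => g v = p).card) c =
      (Finset.univ.filter fun v => g v < c).card := by
  induction c with
  | zero => simp
  | succ c ih =>
    rw [blockStart_succ, ih, ← Finset.card_union_of_disjoint, ← Finset.filter_or]
    · simp only [Nat.lt_succ_iff_lt_or_eq]
    · exact Finset.disjoint_filter.2 fun v _ hlt heq => hlt.ne heq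

end BlockSizes

/-! ### The dynamic program -/

/-- The pair `b` of a value and a block size, or a better one in which `c` represents the last `s`
of the first `i` voters and `D` gives the values for the voters before them. The cost `w v c` is
charged only for the first and the last voter of the block. -/
def tryBlock (w : ℕ → ℕ → ℕ) (D : ℕ → ℕ) (c i s : ℕ) (b : ℕ × ℕ) : ℕ × ℕ :=
  if i < s then b
  else if max (max (D (i - s)) (w (i - s) c)) (w (i - 1) c) < b.1 then
    (max (max (D (i - s)) (w (i - s) c)) (w (i - 1) c), s)
  else b

/-- `blockTable w inf q q' c j i` consists of the optimal value (`inf` if there is no solution) for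
the first `i` voters, to be cut into `j` blocks of size `q` or `q'` and represented by `j` of the
first `c` candidates in their order, and of the size of the block of the last of these candidates
in an optimal solution. -/
def blockTable (w : ℕ → ℕ → ℕ) (inf q q' : ℕ) : ℕ → ℕ → ℕ → ℕ × ℕ
  | 0, j, i => (if j = 0 ∧ i = 0 then 0 else inf, 0)
  | c + 1, 0, i => ((blockTable w inf q q' c 0 i).1, 0)
  | c + 1, j + 1, i =>
    tryBlock w (fun i' => (blockTable w inf q q' c j i').1) c i q'
      (tryBlock w (fun i' => (blockTable w inf q q' c j i').1) c i q
        ((blockTable w inf q q' c (j + 1) i).1, 0))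

/-- The block sizes `f` of the first `c` candidates are `0`, `q` or `q'`, and the nonempty blocks
cost at most `d` at their first and last voters. -/
structure IsBlockSizes (w : ℕ → ℕ → ℕ) (q q' c d : ℕ) (f : ℕ → ℕ) : Prop where
  size : ∀ p < c, f p = 0 ∨ f p = q ∨ f p = q'
  cost : ∀ p < c, f p ≠ 0 → w (blockStart f p) p ≤ d ∧ w (blockStart f (p + 1) - 1) p ≤ d

section BlockTable

variable {w : ℕ → ℕ → ℕ} {inf q q' : ℕ}

theorem tryBlock_fst_le (w : ℕ → ℕ → ℕ) (D : ℕ → ℕ) (c i s : ℕ) (b : ℕ × ℕ) :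
    (tryBlock w D c i s b).1 ≤ b.1 := by
  unfold tryBlock
  split_ifs with h h'
  exacts [le_rfl, h'.le, le_rfl]

theorem tryBlock_fst_le_max (w : ℕ → ℕ → ℕ) (D : ℕ → ℕ) (c : ℕ) {i s : ℕ} (hs : s ≤ i)
    (b : ℕ × ℕ) :
    (tryBlock w D c i s b).1 ≤ max (max (D (i - s)) (w (i - s) c)) (w (i - 1) c) := by
  rw [tryBlock, if_neg hs.not_gt]
  split_ifs with h
  exacts [le_rfl, not_lt.1 h]

theorem tryBlock_eq_or (w : ℕ → ℕ → ℕ) (D : ℕ → ℕ) (c i s : ℕ) (b : ℕ × ℕ) :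
    tryBlock w D c i s b = b ∨
      s ≤ i ∧ tryBlock w D c i s b =
        (max (max (D (i - s)) (w (i - s) c)) (w (i - 1) c), s) := by
  unfold tryBlock
  split_ifs with h h'
  exacts [.inl rfl, .inr ⟨not_lt.1 h, rfl⟩, .inl rfl]

theorem blockTable_succ_fst_le (c j i : ℕ) :
    (blockTable w inf q q' (c + 1) j i).1 ≤ (blockTable w inf q q' c j i).1 := by
  cases j with
  | zero => rw [blockTable]
  | succ j =>
    rw [blockTable]
    exact (tryBlock_fst_le ..).trans (tryBlock_fst_le ..)

theorem blockTable_succ_succ_fst_le {c j i s : ℕ} (hs : s = q ∨ s = q') (hsi : s ≤ i) :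
    (blockTable w inf q q' (c + 1) (j + 1) i).1 ≤
      max (max (blockTable w inf q q' c j (i - s)).1 (w (i - s) c)) (w (i - 1) c) := by
  rw [blockTable]
  rcases hs with rfl | rfl
  · exact (tryBlock_fst_le ..).trans (tryBlock_fst_le_max w _ c hsi _)
  · exact tryBlock_fst_le_max w _ c hsi _

theorem blockTable_succ_eq_or (c j i : ℕ) :
    blockTable w inf q q' (c + 1) j i = ((blockTable w inf q q' c j i).1, 0) ∨
    ∃ j' s, j = j' + 1 ∧ (s = q ∨ s = q') ∧ s ≤ i ∧ blockTable w inf q q' (c + 1) j i =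
      (max (max (blockTable w inf q q' c j' (i - s)).1 (w (i - s) c)) (w (i - 1) c), s) := by
  cases j with
  | zero => exact .inl (by rw [blockTable])
  | succ j =>
    rw [blockTable]
    obtain h' | ⟨hsi, h'⟩ := tryBlock_eq_or w (fun i' => (blockTable w inf q q' c j i').1) c i q'
      (tryBlock w (fun i' => (blockTable w inf q q' c j i').1) c i q
        ((blockTable w inf q q' c (j + 1) i).1, 0))
    · obtain h | ⟨hsi, h⟩ := tryBlock_eq_or w (fun i' => (blockTable w inf q q' c j i').1) c i q
        ((blockTable w inf q q' c (j + 1) i).1, 0)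
      · exact .inl (h'.trans h)
      · exact .inr ⟨j, q, rfl, .inl rfl, hsi, h'.trans h⟩
    · exact .inr ⟨j, q', rfl, .inr rfl, hsi, h'⟩

theorem IsBlockSizes.blockTable_le {c d : ℕ} {f : ℕ → ℕ} (hf : IsBlockSizes w q q' c d f) :
    (blockTable w inf q q' c (blockCount f c) (blockStart f c)).1 ≤ d := by
  induction c with
  | zero => simp [blockTable]
  | succ c ih =>
    have hc := ih ⟨fun p hp => hf.size p (hp.trans c.lt_succ_self),
      fun p hp => hf.cost p (hp.trans c.lt_succ_self)⟩
    by_cases h0 : f c = 0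
    · rw [blockCount_succ, if_neg (not_not.2 h0), blockStart_succ, h0, add_zero, add_zero]
      exact (blockTable_succ_fst_le ..).trans hc
    · obtain ⟨hfst, hlst⟩ := hf.cost c c.lt_succ_self h0
      have hle := blockTable_succ_succ_fst_le (w := w) (inf := inf) (c := c)
        (j := blockCount f c) ((hf.size c c.lt_succ_self).resolve_left h0)
        (le_add_self : f c ≤ blockStart f c + f c)
      rw [Nat.add_sub_cancel, ← blockStart_succ] at hle
      rw [blockCount_succ, if_pos h0]
      exact hle.trans (max_le (max_le hc hfst) hlst)

theorem blockStart_update_of_le {c c' : ℕ} (h : c' ≤ c) (f : ℕ → ℕ) (s : ℕ) :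
    blockStart (Function.update f c s) c' = blockStart f c' :=
  blockStart_congr fun _ hp => Function.update_of_ne (hp.trans_le h).ne _ _

theorem blockCount_update_of_le {c c' : ℕ} (h : c' ≤ c) (f : ℕ → ℕ) (s : ℕ) :
    blockCount (Function.update f c s) c' = blockCount f c' :=
  blockCount_congr fun _ hp => Function.update_of_ne (hp.trans_le h).ne _ _

/-- The block sizes `f` of the first `c` candidates are those recorded in `blockTable`, read off
from its last row backwards. -/
def IsRecorded (w : ℕ → ℕ → ℕ) (inf q q' c : ℕ) (f : ℕ → ℕ) : Prop :=
  ∀ p < c,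
    f p = (blockTable w inf q q' (p + 1) (blockCount f (p + 1)) (blockStart f (p + 1))).2

theorem exists_isRecorded (hq : 0 < q) (hq' : 0 < q') {c j i : ℕ}
    (h : (blockTable w inf q q' c j i).1 < inf) :
    ∃ f, IsRecorded w inf q q' c f ∧ blockCount f c = j ∧ blockStart f c = i := by
  induction c generalizing j i with
  | zero =>
    have hji : j = 0 ∧ i = 0 := by
      by_contra hne
      simp [blockTable, hne] at h
    exact ⟨0, fun p hp => absurd hp p.not_lt_zero, hji.1.symm, hji.2.symm⟩
  | succ c ih =>
    obtain ⟨f, s, hT, hf, hj, hi⟩ : ∃ f s, (blockTable w inf q q' (c + 1) j i).2 = s ∧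
        IsRecorded w inf q q' c f ∧ (blockCount f c + if s ≠ 0 then 1 else 0) = j ∧
        blockStart f c + s = i := by
      rcases blockTable_succ_eq_or (w := w) (inf := inf) (q := q) (q' := q') c j i with
        hT | ⟨j', s, rfl, hs, hsi, hT⟩
      · obtain ⟨f, hf, hj, hi⟩ := ih (by rwa [hT] at h)
        exact ⟨f, 0, by rw [hT], hf, by simpa using hj, hi⟩
      · rw [hT, max_lt_iff, max_lt_iff] at h
        obtain ⟨f, hf, hj, hi⟩ := ih h.1.1
        have hs0 : s ≠ 0 := by rcases hs with rfl | rfl <;> omega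
        exact ⟨f, s, by rw [hT], hf, by rw [hj, if_pos hs0], by omega⟩
    have hj' : blockCount (Function.update f c s) (c + 1) = j := by
      rw [blockCount_succ, Function.update_self, blockCount_update_of_le le_rfl, hj]
    have hi' : blockStart (Function.update f c s) (c + 1) = i := by
      rw [blockStart_succ, Function.update_self, blockStart_update_of_le le_rfl, hi]
    refine ⟨Function.update f c s, fun p hp => ?_, hj', hi'⟩
    rcases Nat.lt_succ_iff_lt_or_eq.1 hp with hp | rfl
    · rw [Function.update_of_ne hp.ne, blockCount_update_of_le hp, blockStart_update_of_le hp]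
      exact hf p hp
    · rw [Function.update_self, hj', hi', hT]

theorem IsBlockSizes.succ {c d d' : ℕ} {f : ℕ → ℕ} (hf : IsBlockSizes w q q' c d f) (hd : d ≤ d')
    (hs : f c = 0 ∨ f c = q ∨ f c = q')
    (hcost : f c ≠ 0 → w (blockStart f c) c ≤ d' ∧ w (blockStart f (c + 1) - 1) c ≤ d') :
    IsBlockSizes w q q' (c + 1) d' f where
  size p hp := by
    rcases Nat.lt_succ_iff_lt_or_eq.1 hp with hp | rfl
    exacts [hf.size p hp, hs]
  cost p hp h := by
    rcases Nat.lt_succ_iff_lt_or_eq.1 hp with hp | rfl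
    exacts [(hf.cost p hp h).imp (le_trans · hd) (le_trans · hd), hcost h]

theorem IsRecorded.isBlockSizes (hq : 0 < q) (hq' : 0 < q') {c : ℕ} {f : ℕ → ℕ}
    (hf : IsRecorded w inf q q' c f) :
    IsBlockSizes w q q' c (blockTable w inf q q' c (blockCount f c) (blockStart f c)).1 f := by
  induction c with
  | zero => exact ⟨fun p hp => absurd hp p.not_lt_zero, fun p hp => absurd hp p.not_lt_zero⟩
  | succ c ih =>
    have hc := ih fun p hp => hf p (hp.trans c.lt_succ_self)
    have hlast := hf c c.lt_succ_self
    rcases blockTable_succ_eq_or (w := w) (inf := inf) (q := q) (q' := q') c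
      (blockCount f (c + 1)) (blockStart f (c + 1)) with hT | ⟨j, s, hj, hs, -, hT⟩
    · obtain h0 : f c = 0 := hlast.trans (by rw [hT])
      rw [hT]
      refine hc.succ (le_of_eq ?_) (.inl h0) (absurd h0)
      rw [blockCount_succ, blockStart_succ, if_neg (not_not.2 h0), h0, add_zero, add_zero]
    · obtain rfl : f c = s := hlast.trans (by rw [hT])
      have h0 : f c ≠ 0 := by rcases hs with h | h <;> omega
      obtain rfl : blockCount f c = j := by
        rw [blockCount_succ, if_pos h0] at hj
        exact Nat.succ_injective hj
      rw [hT, blockStart_succ, Nat.add_sub_cancel]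
      refine hc.succ ((le_max_left _ _).trans (le_max_left _ _)) (.inr hs) fun _ => ?_
      rw [blockStart_succ]
      exact ⟨(le_max_right _ _).trans (le_max_left _ _), le_max_right _ _⟩

end BlockTable

/-! ### Monroe assignments -/

namespace Election

variable {n m : ℕ} {E : Election n m}

theorem linfty_id_le {Φ : Fin n → Fin m} {d : ℕ} :
    E.linfty id Φ ≤ d ↔ ∀ v, E.pos v (Φ v) ≤ d := by
  simp [linfty]

theorem linfty_le_linfty {a : ℕ → ℕ} (ha : MonotoneOn a (Set.Icc 1 m)) {Φ Ψ : Fin n → Fin m}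
    (h : E.linfty id Φ ≤ E.linfty id Ψ) : E.linfty a Φ ≤ E.linfty a Ψ := by
  refine Finset.sup_le fun v _ => ?_
  obtain ⟨u, -, hu⟩ : ∃ u ∈ Finset.univ, E.linfty id Ψ = E.pos u (Ψ u) :=
    Finset.exists_mem_eq_sup _ ⟨v, Finset.mem_univ v⟩ _
  have hvu : E.pos v (Φ v) ≤ E.pos u (Ψ u) := (linfty_id_le.1 h v).trans hu.le
  exact (ha ⟨E.pos_pos _ _, E.pos_le _ _⟩ ⟨E.pos_pos _ _, E.pos_le _ _⟩ hvu).trans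
    (Finset.le_sup (f := fun u => a (E.pos u (Ψ u))) (Finset.mem_univ u))

end Election

theorem ceilDiv_eq_div_add_ite {k : ℕ} (hk : 0 < k) (n : ℕ) :
    n ⌈/⌉ k = n / k + if n % k = 0 then 0 else 1 := by
  have hdvd : n + k - 1 = k * (n / k) + (n % k + k - 1) := by
    have := Nat.div_add_mod n k
    omega
  rw [Nat.ceilDiv_eq_add_pred_div, hdvd, Nat.mul_add_div hk]
  have hlt := Nat.mod_lt n hk
  congr 1
  split_ifs with h
  · rw [h, zero_add]
    exact Nat.div_eq_of_lt (Nat.pred_lt hk.ne')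
  · exact Nat.div_eq_of_lt_le (by omega) (by omega)

section BlockAssignment

variable {n m k : ℕ} {σ : Fin m ≃ Fin m} {f : ℕ → ℕ} {Φ : Fin n → Fin m}

theorem isMonroeAssignment_iff
    (hf : ∀ p : Fin m, (Finset.univ.filter fun v => Φ v = σ p).card = f p) :
    IsMonroeAssignment k Φ ↔
      blockCount f m = k ∧ ∀ p < m, f p = 0 ∨ n / k ≤ f p ∧ f p ≤ n ⌈/⌉ k := by
  have himage : (Finset.univ.image Φ).card = blockCount f m := by
    have hmap : Finset.univ.image Φ =
        (Finset.univ.filter fun p : Fin m => f p ≠ 0).map σ.toEmbedding := by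
      ext c
      obtain ⟨p, rfl⟩ := σ.surjective c
      simp [← hf, Finset.filter_eq_empty_iff]
    rw [hmap, Finset.card_map, blockCount_eq_card_fin]
  constructor
  · rintro ⟨-, hcard, hsize⟩
    exact ⟨himage.symm.trans hcard, fun p hp => by simpa only [hf] using hsize (σ ⟨p, hp⟩)⟩
  · rintro ⟨hcard, hsize⟩
    refine ⟨(himage.trans hcard).le, himage.trans hcard, fun c => ?_⟩
    obtain ⟨p, rfl⟩ := σ.surjective c
    simpa only [hf] using hsize p p.isLt

/-- The `p`-th candidate in the order `σ` represents the voters in the `p`-th block, for the block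
sizes `f`. -/
def IsBlockAssignment (σ : Fin m ≃ Fin m) (f : ℕ → ℕ) (Φ : Fin n → Fin m) : Prop :=
  ∀ (p : Fin m) (v : Fin n), blockStart f p ≤ v → v < blockStart f (p + 1) → Φ v = σ p

namespace IsBlockAssignment

theorem apply_eq_iff (hΦ : IsBlockAssignment σ f Φ) (hf : blockStart f m = n) {v : Fin n}
    {p : Fin m} : Φ v = σ p ↔ blockStart f p ≤ v ∧ v < blockStart f (p + 1) := by
  refine ⟨fun h => ?_, fun h => hΦ p v h.1 h.2⟩
  obtain ⟨p', hp', hv⟩ := exists_block_of_lt_blockStart (v.isLt.trans_eq hf.symm)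
  obtain rfl : ⟨p', hp'⟩ = p := σ.injective ((hΦ ⟨p', hp'⟩ v hv.1 hv.2).symm.trans h)
  exact hv

theorem card_fiber (hΦ : IsBlockAssignment σ f Φ) (hf : blockStart f m = n) (p : Fin m) :
    (Finset.univ.filter fun v => Φ v = σ p).card = f p := by
  have hmap : (Finset.univ.filter fun v => Φ v = σ p).map Fin.valEmbedding =
      Finset.Ico (blockStart f p) (blockStart f (p + 1)) := by
    ext v
    simp only [Finset.mem_map, Finset.mem_filter, Finset.mem_univ, true_and, Finset.mem_Ico,
      Fin.valEmbedding_apply, hΦ.apply_eq_iff hf]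
    exact ⟨fun ⟨_, hv, h⟩ => h ▸ hv, fun h =>
      ⟨⟨v, h.2.trans_le ((blockStart_mono f p.isLt).trans_eq hf)⟩, h, rfl⟩⟩
  rw [← Finset.card_map Fin.valEmbedding, hmap, Nat.card_Ico, blockStart_succ,
    Nat.add_sub_cancel_left]

theorem hasContiguousBlocks (hΦ : IsBlockAssignment σ f Φ) (hf : blockStart f m = n) :
    HasContiguousBlocks Φ := by
  intro u v x huv hvx h
  obtain ⟨p, hp⟩ := σ.surjective (Φ u)
  rw [← hp, eq_comm, hΦ.apply_eq_iff hf] at h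
  rw [← hp, hΦ.apply_eq_iff hf]
  exact ⟨((hΦ.apply_eq_iff hf).1 hp.symm).1.trans huv, lt_of_le_of_lt hvx h.2⟩

end IsBlockAssignment

end BlockAssignment

section Optimal

variable {n m k : ℕ} {E : Election n m} {hn : 0 < n} {w : ℕ → ℕ → ℕ}

-- The valley property reduces the cost of a block to the costs at its two ends.
theorem IsBlockAssignment.linfty_id_le {q q' d : ℕ} {f : ℕ → ℕ} {Φ : Fin n → Fin m}
    (hΦ : IsBlockAssignment (E.ranking ⟨0, hn⟩) f Φ) (hE : E.SingleCrossing) (hN : E.Narcissistic)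
    (hw : ∀ (v : Fin n) (p : Fin m), w v p = E.axisPos hn v p)
    (hd : IsBlockSizes w q q' m d f) (hf : blockStart f m = n) : E.linfty id Φ ≤ d := by
  refine Election.linfty_id_le.2 fun v => ?_
  obtain ⟨p, hp⟩ := (E.ranking ⟨0, hn⟩).surjective (Φ v)
  obtain ⟨hstart, hend⟩ := (hΦ.apply_eq_iff hf).1 hp.symm
  have hle : blockStart f (p + 1) ≤ n := (blockStart_mono f p.isLt).trans_eq hf
  have hne : f p ≠ 0 := by
    rw [blockStart_succ] at hend
    omega
  obtain ⟨hfst, hlst⟩ := hd.cost p p.isLt hne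
  let u : Fin n := ⟨blockStart f p, by omega⟩
  let x : Fin n := ⟨blockStart f (p + 1) - 1, by omega⟩
  calc E.pos v (Φ v) = E.axisPos hn v p := by rw [← hp, Election.axisPos]
    _ ≤ max (E.axisPos hn u p) (E.axisPos hn x p) :=
      hE.axisPos_le_max hN (Fin.le_def.2 hstart) (Fin.le_def.2 (Nat.le_sub_one_of_lt hend)) p
    _ ≤ d := max_le ((hw u p).symm.trans_le hfst) ((hw x p).symm.trans_le hlst)

theorem exists_isBlockSizes_of_isMonroeAssignment (hE : E.SingleCrossing) (hN : E.Narcissistic)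
    (hk : 0 < k) (hw : ∀ (v : Fin n) (p : Fin m), w v p = E.axisPos hn v p) {Ψ : Fin n → Fin m}
    (hΨ : IsMonroeAssignment k Ψ) :
    ∃ f, IsBlockSizes w (n / k) (n ⌈/⌉ k) m (E.linfty id Ψ) f ∧ blockCount f m = k ∧
      blockStart f m = n := by
  let σ := E.ranking ⟨0, hn⟩
  let g (v : Fin n) : Fin m := σ.symm (Ψ v)
  let f (p : ℕ) : ℕ := (Finset.univ.filter fun v => (g v : ℕ) = p).card
  have hstart (c : ℕ) : blockStart f c = (Finset.univ.filter fun v => (g v : ℕ) < c).card :=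
    blockStart_card_fiber (fun v => (g v : ℕ)) c
  have hlast : blockStart f m = n := by simp [hstart]
  have hfiber (p : Fin m) : (Finset.univ.filter fun v => Ψ v = σ p).card = f p := by
    simp only [f, g, Fin.val_inj, Equiv.symm_apply_eq]
  obtain ⟨hcount, hsize⟩ := (isMonroeAssignment_iff hfiber).1 hΨ
  have hceil := ceilDiv_eq_div_add_ite hk n
  refine ⟨f, ⟨fun p hp => ?_, fun p hp hp0 => ?_⟩, hcount, hlast⟩
  · rcases hsize p hp with h | h
    · exact .inl h
    · split_ifs at hceil <;> omega
  have hd (u : Fin n) : E.axisPos hn u (g u) ≤ E.linfty id Ψ := by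
    simpa [Election.axisPos, g, σ] using Election.linfty_id_le.1 le_rfl u
  have hcost (v : ℕ) (hv : blockStart f p ≤ v) (hv' : v < blockStart f (p + 1)) :
      w v p ≤ E.linfty id Ψ := by
    have hvn : v < n := hv'.trans_le ((blockStart_mono f hp).trans_eq hlast)
    rw [hw ⟨v, hvn⟩ ⟨p, hp⟩]
    rw [hstart] at hv hv'
    exact hE.axisPos_sort_le hN hd hv (by simpa only [Nat.lt_succ_iff, Fin.le_def] using hv')
  have hsucc := blockStart_succ f p
  exact ⟨hcost _ le_rfl (by omega), hcost _ (by omega) (by omega)⟩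

theorem exists_isBlockSizes (hk : 0 < k) (hkm : k ≤ m) (hmn : m ≤ n) {d : ℕ}
    (hd : ∀ v < n, ∀ p < m, w v p ≤ d) :
    ∃ f, IsBlockSizes w (n / k) (n ⌈/⌉ k) m d f ∧ blockCount f m = k ∧ blockStart f m = n := by
  have hq : 0 < n / k := Nat.div_pos (hkm.trans hmn) hk
  have hceil := ceilDiv_eq_div_add_ite hk n
  let f (p : ℕ) : ℕ := if p < k then n / k + if p < n % k then 1 else 0 else 0
  have hcount (c : ℕ) : blockCount f c = min c k := by
    induction c with
    | zero => simp
    | succ c ih =>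
      rw [blockCount_succ, ih]
      by_cases hc : c < k <;> simp only [f, hc, if_true, if_false] <;> split_ifs <;> omega
  have hstart (c : ℕ) : blockStart f c = min c k * (n / k) + min c (n % k) := by
    induction c with
    | zero => simp
    | succ c ih =>
      have hmod := Nat.mod_lt n hk
      rw [blockStart_succ, ih]
      by_cases hc : c < k
      · rw [min_eq_left hc.le, min_eq_left (Nat.succ_le_of_lt hc), Nat.succ_mul]
        simp only [f, hc, if_true]
        split_ifs <;> omega
      · rw [min_eq_right (not_lt.1 hc), min_eq_right ((not_lt.1 hc).trans c.le_succ)]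
        simp only [f, hc, if_false]
        omega
  have hlast : blockStart f m = n := by
    rw [hstart, min_eq_right hkm, min_eq_right ((Nat.mod_lt n hk).le.trans hkm), Nat.div_add_mod]
  refine ⟨f, ⟨fun p _ => ?_, fun p hp hp0 => ?_⟩, (hcount m).trans (min_eq_right hkm), hlast⟩
  · simp only [f]
    split_ifs at hceil ⊢ <;> omega
  · have hle : blockStart f (p + 1) ≤ n := (blockStart_mono f hp).trans_eq hlast
    have hsucc := blockStart_succ f p
    exact ⟨hd _ (by omega) p hp, hd _ (by omega) p hp⟩

theorem exists_isRecorded_of_forall_le (hk : 0 < k) (hkm : k ≤ m) (hmn : m ≤ n) {d inf : ℕ}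
    (hd : ∀ v < n, ∀ p < m, w v p ≤ d) (hinf : d < inf) :
    ∃ f, IsRecorded w inf (n / k) (n ⌈/⌉ k) m f ∧ blockCount f m = k ∧ blockStart f m = n := by
  have hq : 0 < n / k := Nat.div_pos (hkm.trans hmn) hk
  have hq' : n / k ≤ n ⌈/⌉ k := Nat.floorDiv_eq_div n k ▸ floorDiv_le_ceilDiv
  obtain ⟨g, hg, hcount, hlast⟩ := exists_isBlockSizes hk hkm hmn hd
  have hle := hg.blockTable_le (inf := inf)
  rw [hcount, hlast] at hle
  exact exists_isRecorded hq (hq.trans_le hq') (hle.trans_lt hinf)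

theorem isOptimalMonroe_of_isRecorded {a : ℕ → ℕ} (ha : MonotoneOn a (Set.Icc 1 m))
    (hE : E.SingleCrossing) (hN : E.Narcissistic) (hk : 0 < k) (hkm : k ≤ m)
    (hw : ∀ (v : Fin n) (p : Fin m), w v p = E.axisPos hn v p) {inf : ℕ} {f : ℕ → ℕ}
    (hf : IsRecorded w inf (n / k) (n ⌈/⌉ k) m f) (hcount : blockCount f m = k)
    (hlast : blockStart f m = n) {Φ : Fin n → Fin m}
    (hΦ : IsBlockAssignment (E.ranking ⟨0, hn⟩) f Φ) : E.IsOptimalMonroe a k Φ := by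
  have hq : 0 < n / k := Nat.div_pos (hkm.trans hN.le) hk
  have hq' : n / k ≤ n ⌈/⌉ k := Nat.floorDiv_eq_div n k ▸ floorDiv_le_ceilDiv
  have hsizes := hf.isBlockSizes hq (hq.trans_le hq')
  rw [hcount, hlast] at hsizes
  refine ⟨(isMonroeAssignment_iff (hΦ.card_fiber hlast)).2 ⟨hcount, fun p hp => ?_⟩,
    fun Ψ hΨ => Election.linfty_le_linfty ha ?_⟩
  · rcases hsizes.size p hp with h | h | h <;> omega
  · obtain ⟨f', hf', hcount', hlast'⟩ :=
      exists_isBlockSizes_of_isMonroeAssignment hE hN hk hw hΨ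
    have hle := hf'.blockTable_le (inf := inf)
    rw [hcount', hlast'] at hle
    exact (hΦ.linfty_id_le hE hN hw hsizes hlast).trans hle

end Optimal

/-! ### Reasoning about programs -/

namespace RAMState

@[simp]
theorem setReg_reg (s : RAMState) (x v y : ℕ) :
    (s.setReg x v).reg y = if y = x then v else s.reg y := by
  simp [setReg, Function.update_apply]

@[simp]
theorem setReg_arr (s : RAMState) (x v : ℕ) : (s.setReg x v).arr = s.arr :=
  rfl

@[simp]
theorem setArr_reg (s : RAMState) (a i v : ℕ) : (s.setArr a i v).reg = s.reg :=
  rfl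

@[simp]
theorem setArr_arr (s : RAMState) (a i v b : ℕ) :
    (s.setArr a i v).arr b = if b = a then Function.update (s.arr a) i v else s.arr b := by
  simp [setArr, Function.update_apply]

end RAMState

local notation:60 p:61 ";;" q:60 => RAMProg.seq p q

namespace RAMProg

/-- The registers that a program may write to. -/
def regWrites : RAMProg → List ℕ
  | const x _ | copy x _ | add x _ _ | sub x _ _ | load x _ _ => [x]
  | seq p q | ifLt _ _ p q => p.regWrites ++ q.regWrites
  | whileLt _ _ p => p.regWrites
  | _ => []

/-- The arrays that a program may write to. -/
def arrWrites : RAMProg → List ℕ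
  | store a _ _ => [a]
  | seq p q | ifLt _ _ p q => p.arrWrites ++ q.arrWrites
  | whileLt _ _ p => p.arrWrites
  | _ => []

/-- The states `s` and `s'` agree on the memory that `p` does not write to. -/
structure Frame (p : RAMProg) (s s' : RAMState) : Prop where
  reg : ∀ x ∉ p.regWrites, s'.reg x = s.reg x
  arr : ∀ a ∉ p.arrWrites, s'.arr a = s.arr a

theorem Frame.seq {p q : RAMProg} {s s' s'' : RAMState} (h : p.Frame s s') (h' : q.Frame s' s'') :
    (p ;; q).Frame s s'' where
  reg x hx := by
    simp only [regWrites, List.mem_append, not_or] at hx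
    rw [h'.reg x hx.2, h.reg x hx.1]
  arr a ha := by
    simp only [arrWrites, List.mem_append, not_or] at ha
    rw [h'.arr a ha.2, h.arr a ha.1]

theorem Runs.frame {p : RAMProg} {s s' : RAMState} {t : ℕ} (h : p.Runs s t s') :
    p.Frame s s' where
  reg x hx := by induction h <;> simp_all [regWrites]
  arr a ha := by induction h <;> simp_all [arrWrites]

/-- Started in `s`, the program `p` halts within `B` steps in a state that satisfies `Q`. -/
def HaltsIn (p : RAMProg) (s : RAMState) (B : ℕ) (Q : RAMState → Prop) : Prop :=
  ∃ (t : ℕ) (s' : RAMState), p.Runs s t s' ∧ t ≤ B ∧ Q s'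

section HaltsIn

variable {p q : RAMProg} {s : RAMState} {B B' : ℕ} {Q Q' : RAMState → Prop}

theorem HaltsIn.mono (h : p.HaltsIn s B Q) (hB : B ≤ B') (hQ : ∀ s', p.Frame s s' → Q s' → Q' s') :
    p.HaltsIn s B' Q' := by
  obtain ⟨t, s', hr, ht, hs⟩ := h
  exact ⟨t, s', hr, ht.trans hB, hQ s' hr.frame hs⟩

theorem HaltsIn.seq (h : p.HaltsIn s B Q)
    (h' : ∀ s', p.Frame s s' → Q s' → q.HaltsIn s' B' Q') : (p ;; q).HaltsIn s (B + B') Q' := by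
  obtain ⟨t, s', hr, ht, hs⟩ := h
  obtain ⟨t', s'', hr', ht', hs'⟩ := h' s' hr.frame hs
  exact ⟨t + t', s'', .seq hr hr', Nat.add_le_add ht ht', hs'⟩

-- The index `d` of the invariant is the number of iterations to come.
theorem HaltsIn.whileLt {x y N : ℕ} (I : ℕ → RAMState → Prop) (h : I N s)
    (hstep : ∀ d < N, ∀ s', p.Frame s s' → I (d + 1) s' →
      s'.reg x < s'.reg y ∧ p.HaltsIn s' B (I d))
    (hend : ∀ s', p.Frame s s' → I 0 s' → ¬ s'.reg x < s'.reg y) :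
    (RAMProg.whileLt x y p).HaltsIn s (N * (B + 1) + 1) (I 0) := by
  suffices H : ∀ d ≤ N, ∀ s', p.Frame s s' → I d s' →
      (RAMProg.whileLt x y p).HaltsIn s' (d * (B + 1) + 1) (I 0) from
    H N le_rfl s ⟨fun _ _ => rfl, fun _ _ => rfl⟩ h
  intro d
  induction d with
  | zero => exact fun _ s' hf hI => ⟨1, s', .while_false (hend s' hf hI), by simp, hI⟩
  | succ d ih =>
    intro hd s' hf hI
    obtain ⟨hlt, t, s₁, hr, ht, hI₁⟩ := hstep d hd s' hf hI
    have hf₁ : p.Frame s s₁ := ⟨fun x hx => (hr.frame.reg x hx).trans (hf.reg x hx),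
      fun a ha => (hr.frame.arr a ha).trans (hf.arr a ha)⟩
    obtain ⟨t', s₂, hr', ht', hI₂⟩ := ih (Nat.le_of_succ_le hd) s₁ hf₁ hI₁
    refine ⟨t + t' + 1, s₂, .while_true hlt hr hr', ?_, hI₂⟩
    rw [Nat.succ_mul]
    omega

end HaltsIn

/-! #### Programs without loops -/

/-- The program has no loops. -/
def isLoopFree : RAMProg → Bool
  | seq p q | ifLt _ _ p q => p.isLoopFree && q.isLoopFree
  | whileLt _ _ _ => false
  | _ => true

/-- The number of instructions and tests of a program. -/
def size : RAMProg → ℕ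
  | seq p q => p.size + q.size
  | ifLt _ _ p q => p.size + q.size + 1
  | whileLt _ _ p => p.size + 1
  | _ => 1

/-- The state in which a program without loops halts. -/
def exec : RAMProg → RAMState → RAMState
  | skip, s => s
  | const x c, s => s.setReg x c
  | copy x y, s => s.setReg x (s.reg y)
  | add x y z, s => s.setReg x (s.reg y + s.reg z)
  | sub x y z, s => s.setReg x (s.reg y - s.reg z)
  | load x a y, s => s.setReg x (s.arr a (s.reg y))
  | store a x y, s => s.setArr a (s.reg x) (s.reg y)
  | seq p q, s => q.exec (p.exec s)
  | ifLt x y p q, s => if s.reg x < s.reg y then p.exec s else q.exec s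
  | whileLt _ _ _, s => s

section LoopFree

variable {p q : RAMProg} {s : RAMState} {B : ℕ} {Q : RAMState → Prop}

theorem exists_runs_exec (hp : p.isLoopFree) (s : RAMState) :
    ∃ t ≤ p.size, p.Runs s t (p.exec s) := by
  induction p generalizing s with
  | skip => exact ⟨1, le_rfl, .skip s⟩
  | const x c => exact ⟨1, le_rfl, .const s x c⟩
  | copy x y => exact ⟨1, le_rfl, .copy s x y⟩
  | add x y z => exact ⟨1, le_rfl, .add s x y z⟩
  | sub x y z => exact ⟨1, le_rfl, .sub s x y z⟩
  | load x a y => exact ⟨1, le_rfl, .load s x a y⟩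
  | store a x y => exact ⟨1, le_rfl, .store s a x y⟩
  | seq p q ihp ihq =>
    simp only [isLoopFree, Bool.and_eq_true] at hp
    obtain ⟨t, ht, hr⟩ := ihp hp.1 s
    obtain ⟨t', ht', hr'⟩ := ihq hp.2 (p.exec s)
    exact ⟨t + t', Nat.add_le_add ht ht', .seq hr hr'⟩
  | ifLt x y p q ihp ihq =>
    simp only [isLoopFree, Bool.and_eq_true] at hp
    rw [exec, size]
    split_ifs with h
    · obtain ⟨t, ht, hr⟩ := ihp hp.1 s
      exact ⟨t + 1, by omega, .ifLt_true h hr⟩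
    · obtain ⟨t, ht, hr⟩ := ihq hp.2 s
      exact ⟨t + 1, by omega, .ifLt_false h hr⟩
  | whileLt => simp [isLoopFree] at hp

theorem frame_exec (hp : p.isLoopFree) (s : RAMState) : p.Frame s (p.exec s) := by
  obtain ⟨t, -, hr⟩ := exists_runs_exec hp s
  exact hr.frame

theorem HaltsIn.of_exec (hp : p.isLoopFree) (hB : p.size ≤ B) (hQ : Q (p.exec s)) :
    p.HaltsIn s B Q := by
  obtain ⟨t, ht, hr⟩ := exists_runs_exec hp s
  exact ⟨t, _, hr, ht.trans hB, hQ⟩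

end LoopFree

/-- Set register `x` to the maximum of the registers `x` and `y`. -/
def maxInto (x y : ℕ) : RAMProg :=
  ifLt x y (copy x y) skip

theorem exec_maxInto (x y : ℕ) (s : RAMState) :
    (maxInto x y).exec s = s.setReg x (max (s.reg x) (s.reg y)) := by
  simp only [maxInto, exec]
  split_ifs with h
  · rw [max_eq_right h.le]
  · rw [max_eq_left (not_lt.1 h), RAMState.setReg, Function.update_eq_self]

/-- Run `p` with register `x` counting from `0` up to, but not including, the content of register
`y`. Register `u` has to contain `1`. -/
def forLt (u x y : ℕ) (p : RAMProg) : RAMProg :=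
  const x 0 ;; whileLt x y (p ;; add x x u)

theorem HaltsIn.forLt {u x y N B : ℕ} {p : RAMProg} {s : RAMState} (I : ℕ → RAMState → Prop)
    (hu : s.reg u = 1) (hy : s.reg y = N) (hx : x ∉ p.regWrites) (hup : u ∉ x :: p.regWrites)
    (hyp : y ∉ x :: p.regWrites) (hI : ∀ i s' v, I i s' → I i (s'.setReg x v)) (h0 : I 0 s)
    (hstep : ∀ i < N, ∀ s', (RAMProg.forLt u x y p).Frame s s' → s'.reg x = i → I i s' →
      p.HaltsIn s' B (I (i + 1))) :
    (RAMProg.forLt u x y p).HaltsIn s (N * (B + 2) + 2) (I N) := by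
  have hframe {s'} (hf : (p ;; add x x u).Frame (s.setReg x 0) s') :
      (RAMProg.forLt u x y p).Frame s s' := by
    refine ⟨fun z hz => ?_, fun a ha => ?_⟩
    · simp only [RAMProg.forLt, regWrites, List.mem_append, List.mem_singleton, not_or] at hz
      simpa [hz.1] using hf.reg z (by simp [regWrites, hz.2])
    · simpa using hf.arr a (by simpa [RAMProg.forLt, arrWrites] using ha)
  have hloop : (RAMProg.whileLt x y (p ;; add x x u)).HaltsIn (s.setReg x 0)
      (N * (B + 2) + 1) fun s' => 0 ≤ N ∧ s'.reg x = N - 0 ∧ I (N - 0) s' := by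
    refine .whileLt (B := B + 1) (fun d s' => d ≤ N ∧ s'.reg x = N - d ∧ I (N - d) s')
      ⟨le_rfl, by simp, by simpa using hI 0 s 0 h0⟩ (fun d hd s' hf ⟨_, hxs, hIs⟩ => ⟨?_, ?_⟩)
      fun s' hf ⟨_, hxs, _⟩ => ?_
    · rw [hxs, (hframe hf).reg y (by simp_all [RAMProg.forLt, regWrites]), hy]
      omega
    · refine (hstep _ (by omega) s' (hframe hf) hxs hIs).seq fun s₁ hf₁ hI₁ =>
        .of_exec rfl le_rfl ⟨hd.le, ?_, ?_⟩
      · have hx₁ := hf₁.reg x hx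
        have hu₁ := (hf₁.reg u (by simp_all)).trans
          ((hframe hf).reg u (by simp_all [RAMProg.forLt, regWrites]))
        simp only [exec, RAMState.setReg_reg, if_true]
        omega
      · rw [show N - d = N - (d + 1) + 1 by omega]
        exact hI _ _ _ hI₁
    · rw [hxs, (hframe hf).reg y (by simp_all [RAMProg.forLt, regWrites]), hy]
      omega
  have hfirst : (const x 0).HaltsIn s 1 fun s' => s' = s.setReg x 0 := .of_exec rfl le_rfl rfl
  exact (hfirst.seq fun _ _ hs => hs ▸ hloop).mono (by omega) fun s' _ h => h.2.2

end RAMProg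

namespace RAMProg

/-! #### Memory layout -/

section Layout

@[simp] abbrev regN : ℕ := 0
@[simp] abbrev regM : ℕ := 1
@[simp] abbrev regK : ℕ := 2
@[simp] abbrev regOne : ℕ := 3
@[simp] abbrev regZero : ℕ := 4
@[simp] abbrev regFloor : ℕ := 5
@[simp] abbrev regFloorM : ℕ := 6
@[simp] abbrev regCeil : ℕ := 7
@[simp] abbrev regCeilM : ℕ := 8
@[simp] abbrev regInf : ℕ := 9
@[simp] abbrev regN1 : ℕ := 10
@[simp] abbrev regK1 : ℕ := 11
@[simp] abbrev regLayer : ℕ := 12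

-- The registers from here on are working memory.
@[simp] abbrev regX : ℕ := 13
@[simp] abbrev regP : ℕ := 14
@[simp] abbrev regJ : ℕ := 15
@[simp] abbrev regI : ℕ := 16
@[simp] abbrev regT : ℕ := 17
@[simp] abbrev regC : ℕ := 18
@[simp] abbrev regCell : ℕ := 19
@[simp] abbrev regU : ℕ := 20
@[simp] abbrev regBest : ℕ := 21
@[simp] abbrev regSize : ℕ := 22
@[simp] abbrev regD : ℕ := 23
@[simp] abbrev regA : ℕ := 24
@[simp] abbrev regY : ℕ := 25

@[simp] abbrev arrRank : ℕ := 0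
@[simp] abbrev arrOut : ℕ := 2
@[simp] abbrev arrPos : ℕ := 3
@[simp] abbrev arrVal : ℕ := 4
@[simp] abbrev arrSize : ℕ := 5

end Layout

/-- The parameters of the dynamic program, which the registers `0` to `12` hold from the end of
`setup` on. As there is no multiplication, the products that occur in addresses are kept too. -/
structure Params (n m k : ℕ) (s : RAMState) : Prop where
  n_eq : s.reg regN = n
  m_eq : s.reg regM = m
  k_eq : s.reg regK = k
  one_eq : s.reg regOne = 1
  zero_eq : s.reg regZero = 0
  floor_eq : s.reg regFloor = n / k
  floorM_eq : s.reg regFloorM = n / k * m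
  ceil_eq : s.reg regCeil = n ⌈/⌉ k
  ceilM_eq : s.reg regCeilM = n ⌈/⌉ k * m
  inf_eq : s.reg regInf = m + 1
  n1_eq : s.reg regN1 = n + 1
  k1_eq : s.reg regK1 = k + 1
  layer_eq : s.reg regLayer = (k + 1) * (n + 1)

theorem Params.frame {n m k : ℕ} {p : RAMProg} {s s' : RAMState} (h : Params n m k s)
    (hf : p.Frame s s') (hp : ∀ x ∈ p.regWrites, 13 ≤ x) : Params n m k s' := by
  have hreg (x : ℕ) (hx : x < 13) : s'.reg x = s.reg x :=
    hf.reg x fun hmem => absurd (hp x hmem) (by omega)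
  obtain ⟨⟩ := h
  constructor <;> rw [hreg _ (by simp)] <;> assumption

/-! #### Setting up the parameters -/

/-- Set up the parameters that are independent of `n / k`. -/
def initParams : RAMProg :=
  const regOne 1 ;; const regZero 0 ;; const regFloor 0 ;; const regFloorM 0 ;; const regLayer 0 ;;
    add regInf regM regOne ;; add regN1 regN regOne ;; add regK1 regK regOne ;; copy regX regN1

/-- Divide `n` by `k`, leaving `n % k + 1` in register `regX`. -/
def divide : RAMProg :=
  whileLt regK regX
    (sub regX regX regK ;; add regFloor regFloor regOne ;; add regFloorM regFloorM regM)

/-- Set up the larger block size. -/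
def setCeil : RAMProg :=
  copy regCeil regFloor ;; copy regCeilM regFloorM ;;
    ifLt regOne regX (add regCeil regCeil regOne ;; add regCeilM regCeilM regM) skip

/-- Set up the size of a layer of the table. -/
def setLayer : RAMProg :=
  forLt regOne regX regK1 (add regLayer regLayer regN1)

/-- Set up the parameters of the dynamic program. -/
def setup : RAMProg :=
  initParams ;; divide ;; setCeil ;; setLayer

section Setup

variable {n m k : ℕ} {s : RAMState}

theorem haltsIn_divide (hk : 0 < k) (hm : s.reg regM = m) (hsk : s.reg regK = k)
    (hone : s.reg regOne = 1) (hfloor : s.reg regFloor = 0) (hfloorM : s.reg regFloorM = 0)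
    (hx : s.reg regX = n + 1) :
    divide.HaltsIn s (n / k * 4 + 1) fun s' => s'.reg regFloor = n / k ∧
      s'.reg regFloorM = n / k * m ∧ s'.reg regX = n % k + 1 := by
  refine (HaltsIn.whileLt (B := 3) (fun d s' => s'.reg regFloor + d = n / k ∧
      s'.reg regFloorM + d * m = n / k * m ∧ s'.reg regX = n % k + 1 + d * k)
    ⟨by omega, by omega, ?_⟩ (fun d _ s' hf ⟨_, hqm, hr⟩ => ?_)
    fun s' hf ⟨_, _, hr⟩ => ?_).mono le_rfl fun s' _ ⟨hq, hqm, hr⟩ => ?_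
  · rw [hx, mul_comm, add_right_comm, Nat.mod_add_div]
  · have hk' : s'.reg regK = k := (hf.reg regK (by decide)).trans hsk
    have hm' : s'.reg regM = m := (hf.reg regM (by decide)).trans hm
    have hone' : s'.reg regOne = 1 := (hf.reg regOne (by decide)).trans hone
    rw [Nat.succ_mul] at hqm hr
    refine ⟨by omega, .of_exec rfl (by decide) ?_⟩
    simp only [regX, regK, regFloor, regFloorM, regM, regOne] at *
    simp [exec, *]
    omega
  · have hk' : s'.reg regK = k := (hf.reg regK (by decide)).trans hsk
    have := Nat.mod_lt n hk
    rw [hk', hr]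
    omega
  · exact ⟨hq, by simpa using hqm, by simpa using hr⟩

theorem haltsIn_setLayer (hone : s.reg regOne = 1) (hn : s.reg regN1 = n + 1)
    (hk : s.reg regK1 = k + 1) (hlayer : s.reg regLayer = 0) :
    setLayer.HaltsIn s ((k + 1) * 3 + 2) fun s' => s'.reg regLayer = (k + 1) * (n + 1) := by
  refine .forLt (B := 1) (fun i s' => s'.reg regLayer = i * (n + 1)) hone hk (by decide) (by decide)
    (by decide) (by simp) (by simpa using hlayer) fun i _ s' hf _ hi => .of_exec rfl le_rfl ?_
  have hn' : s'.reg regN1 = n + 1 := (hf.reg regN1 (by decide)).trans hn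
  simp_all [exec, Nat.succ_mul]

theorem haltsIn_setCeil (hk : 0 < k) (hm : s.reg regM = m) (hone : s.reg regOne = 1)
    (hfloor : s.reg regFloor = n / k) (hfloorM : s.reg regFloorM = n / k * m)
    (hx : s.reg regX = n % k + 1) :
    setCeil.HaltsIn s 6 fun s' => s'.reg regCeil = n ⌈/⌉ k ∧ s'.reg regCeilM = n ⌈/⌉ k * m := by
  refine .of_exec rfl (by decide) ?_
  rw [ceilDiv_eq_div_add_ite hk]
  simp only [regM, regOne, regFloor, regFloorM, regX] at *
  by_cases h : n % k = 0
  · simp [setCeil, exec, *]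
  · simp [setCeil, exec, *, Nat.pos_of_ne_zero h, Nat.succ_mul]

theorem haltsIn_setup (hk : 0 < k) (hn : s.reg regN = n) (hm : s.reg regM = m)
    (hsk : s.reg regK = k) : setup.HaltsIn s (n / k * 4 + (k + 1) * 3 + 18) (Params n m k) := by
  obtain ⟨s₀, hs₀⟩ : ∃ s₀, s₀ = initParams.exec s := ⟨_, rfl⟩
  simp only [initParams, exec, regN, regM, regK] at hs₀ hn hm hsk
  have hparams : initParams.HaltsIn s 9 (· = s₀) := .of_exec rfl le_rfl hs₀.symm
  have hdivide := haltsIn_divide (s := s₀) (n := n) (m := m) hk (by simp [hs₀, hm])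
    (by simp [hs₀, hsk]) (by simp [hs₀]) (by simp [hs₀]) (by simp [hs₀]) (by simp [hs₀, hn])
  refine HaltsIn.mono (hparams.seq fun s' _ hs' => hs' ▸ hdivide.seq fun s₁ hf₁ ⟨hq, hqm, hx⟩ =>
    (haltsIn_setCeil (m := m) hk ?_ ?_ hq hqm hx).seq fun s₂ hf₂ ⟨hceil, hceilM⟩ =>
      (haltsIn_setLayer (n := n) (k := k) ?_ ?_ ?_ ?_).mono le_rfl fun s₃ hf₃ hlayer => ?_)
        (by omega) fun _ _ h => h
  · rw [hf₁.reg _ (by decide)]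
    simp [hs₀, hm]
  · rw [hf₁.reg _ (by decide)]
    simp [hs₀]
  iterate 4
    rw [(hf₁.seq hf₂).reg _ (by decide)]
    simp [hs₀, hn, hsk]
  have hf := (hf₁.seq hf₂).seq hf₃
  refine ⟨?_, ?_, ?_, ?_, ?_, (hf₂.seq hf₃).reg _ (by decide) |>.trans hq,
    (hf₂.seq hf₃).reg _ (by decide) |>.trans hqm, (hf₃.reg _ (by decide)).trans hceil,
    (hf₃.reg _ (by decide)).trans hceilM, ?_, ?_, ?_, hlayer⟩
  all_goals
    rw [hf.reg _ (by decide)]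
    simp [hs₀, hn, hm, hsk]

end Setup

end RAMProg

theorem mul_add_eq_mul_add_iff_of_lt {a b c d m : ℕ} (hb : b < m) (hd : d < m) :
    a * m + b = c * m + d ↔ a = c ∧ b = d := by
  refine ⟨fun h => ?_, fun ⟨ha, hb⟩ => ha ▸ hb ▸ rfl⟩
  have hm : 0 < m := Nat.zero_lt_of_lt hb
  obtain ⟨ha, hb'⟩ := (Nat.div_mod_unique (d := a) hm).2 ⟨by rw [add_comm, mul_comm], hb⟩
  obtain ⟨hc, hd'⟩ := (Nat.div_mod_unique (d := c) hm).2 ⟨by rw [add_comm, mul_comm], hd⟩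
  exact ⟨ha.symm.trans (h ▸ hc), hb'.symm.trans (h ▸ hd')⟩

namespace RAMProg

/-! #### Tabulating the positions -/

/-- The innermost part of `fillPos`: voter `regI` ranks a candidate in place `regP`. -/
def recordPos : RAMProg :=
  add regA regCell regP ;; load regC arrRank regA ;; add regA regCell regC ;;
    add regD regP regOne ;; store arrPos regA regD

/-- Invert the rankings: array `arrPos` receives the positions of the candidates. -/
def fillPos : RAMProg :=
  const regCell 0 ;; forLt regOne regI regN
    (forLt regOne regP regM recordPos ;; add regCell regCell regM)

/-- Array `arrPos` holds the positions that the voters before `v` assign to the candidates, and the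
positions up to `r` that voter `v` assigns. -/
def HoldsPos {n m : ℕ} (E : Election n m) (v r : ℕ) (s : RAMState) : Prop :=
  ∀ (u : Fin n) (c : Fin m), u < v ∨ u = v ∧ E.pos u c ≤ r → s.arr arrPos (u * m + c) = E.pos u c

section FillPos

variable {n m k : ℕ} {s : RAMState} {E : Election n m}

theorem HoldsPos.exec_recordPos {v : Fin n} {r : Fin m} (h : HoldsPos E v r s)
    (hone : s.reg regOne = 1) (hcell : s.reg regCell = v * m) (hr : s.reg regP = r)
    (hE : s.arr arrRank (v * m + r) = E.ranking v r) :
    HoldsPos E v (r + 1) (recordPos.exec s) := by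
  intro u c huc
  simp only [regOne, regCell, regP, arrRank] at hone hcell hr hE
  suffices Function.update (s.arr arrPos) (v * m + E.ranking v r) (r + 1) (u * m + c) =
      E.pos u c by simpa [recordPos, exec, hone, hcell, hr, hE]
  rw [Function.update_apply]
  split_ifs with heq
  · obtain ⟨hu, hc⟩ := (mul_add_eq_mul_add_iff_of_lt c.2 (E.ranking v r).2).1 heq
    rw [Fin.ext hu, Fin.ext hc, Election.pos_ranking]
  · refine h u c (huc.imp_right fun ⟨hu, hc⟩ => ⟨hu, ?_⟩)
    refine Nat.le_of_lt_succ <| hc.lt_of_ne fun hrank => heq ?_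
    obtain rfl : u = v := Fin.ext hu
    rw [← (E.ranking u).symm_apply_eq.1 (Fin.ext (Nat.succ_injective hrank))]

theorem haltsIn_forLt_recordPos (hs : Params n m k s) {v : Fin n} (hcell : s.reg regCell = v * m)
    (hE : ∀ r : Fin m, s.arr arrRank (v * m + r) = E.ranking v r) (h : HoldsPos E v 0 s) :
    (forLt regOne regP regM recordPos).HaltsIn s (m * 7 + 2) (HoldsPos E v m) := by
  refine .forLt (HoldsPos E v) hs.one_eq hs.m_eq (by decide) (by decide) (by decide)
    (by simp [HoldsPos]) h fun r hr s' hf hr' hpos => .of_exec rfl le_rfl ?_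
  refine hpos.exec_recordPos (r := ⟨r, hr⟩) ?_ ?_ hr' ?_
  · rw [hf.reg _ (by decide), hs.one_eq]
  · rw [hf.reg _ (by decide), hcell]
  · rw [hf.arr _ (by decide), hE]

theorem haltsIn_fillPos (hs : Params n m k s)
    (hE : ∀ (v : Fin n) (r : Fin m), s.arr arrRank (v * m + r) = E.ranking v r) :
    fillPos.HaltsIn s (n * (m * 7 + 5) + 3) fun s' =>
      ∀ (v : Fin n) (c : Fin m), s'.arr arrPos (v * m + c) = E.pos v c := by
  have hcell₀ : (const regCell 0).HaltsIn s 1 fun s' => s'.reg regCell = 0 :=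
    .of_exec rfl le_rfl (by simp [exec])
  refine HaltsIn.mono (hcell₀.seq fun s₀ hf₀ hcell₀ => .forLt (N := n) (B := m * 7 + 3)
    (fun v s' => s'.reg regCell = v * m ∧ HoldsPos E v 0 s') (hs.frame hf₀ (by decide)).one_eq
    (hs.frame hf₀ (by decide)).n_eq (by decide) (by decide) (by decide) (by simp [HoldsPos])
    ⟨by simp [hcell₀], by simp [HoldsPos, Election.pos]⟩ fun v hv s₁ hf₁ _ ⟨hcell, hpos⟩ => ?_)
    (by rw [add_comm]) fun s' _ ⟨_, hpos⟩ v c => hpos v c (.inl v.2)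
  have hs₁ := hs.frame (hf₀.seq hf₁) (by decide)
  refine (haltsIn_forLt_recordPos hs₁ (v := ⟨v, hv⟩) hcell (fun r => ?_) hpos).seq
    fun s₂ hf₂ hpos₂ => .of_exec rfl le_rfl ⟨?_, fun u c huc => ?_⟩
  · rw [(hf₀.seq hf₁).arr _ (by decide), hE]
  · have hm := (hs₁.frame hf₂ (by decide)).m_eq
    have hcell₂ := (hf₂.reg _ (by decide)).trans hcell
    simp only [regCell, regM] at hcell₂ hm
    simp [exec, hcell₂, hm, Nat.succ_mul]
  · refine hpos₂ u c ?_
    have := E.pos_le u c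
    have := E.pos_pos u c
    simp only
    omega

end FillPos

end RAMProg

namespace RAMProg

/-! #### Filling the table -/

/-- The table of the dynamic program for `k`-Monroe assignments. Entries above `m` are infinite. -/
abbrev monroeTable (w : ℕ → ℕ → ℕ) (n m k : ℕ) : ℕ → ℕ → ℕ → ℕ × ℕ :=
  blockTable w (m + 1) (n / k) (n ⌈/⌉ k)

/-- The address of entry `j`, `i` of layer `c` of the table, whose layers have `k + 1` rows of
`n + 1` entries each. -/
def tableIndex (n k c j i : ℕ) : ℕ :=
  (c * (k + 1) + j) * (n + 1) + i

/-- The arrays `arrVal` and `arrSize` hold the entries of the table `T` at the addresses below `t`,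
and `regT` holds `t`. The block sizes in layer `0` are not stored. -/
structure FilledBelow (n k : ℕ) (T : ℕ → ℕ → ℕ → ℕ × ℕ) (t : ℕ) (s : RAMState) : Prop where
  next : s.reg regT = t
  val : ∀ c j i, j ≤ k → i ≤ n → tableIndex n k c j i < t →
    s.arr arrVal (tableIndex n k c j i) = (T c j i).1
  size : ∀ c j i, j ≤ k → i ≤ n → tableIndex n k (c + 1) j i < t →
    s.arr arrSize (tableIndex n k (c + 1) j i) = (T (c + 1) j i).2

/-- Fill layer `0` of the table. -/
def initTable : RAMProg :=
  forLt regOne regX regLayer (store arrVal regX regInf) ;; store arrVal regZero regZero ;;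
    copy regT regLayer

/-- Compute the value of the solutions whose last block has its size in the register `q`. The
register `qm` holds the product of this size and `m`. -/
def blockValue (q qm : ℕ) : RAMProg :=
  sub regA regU q ;; load regD arrVal regA ;;
    sub regA regCell qm ;; load regY arrPos regA ;; maxInto regD regY ;;
    sub regA regCell regM ;; load regY arrPos regA ;; maxInto regD regY

/-- Improve the value `regBest` and the block size `regSize` of a table entry by `blockValue`. -/
def improve (q qm : ℕ) : RAMProg :=
  ifLt regI q skip
    (blockValue q qm ;; ifLt regD regBest (copy regBest regD ;; copy regSize q) skip)

/-- Improve the value and the block size of a table entry by both block sizes. -/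
def improveBoth : RAMProg :=
  improve regFloor regFloorM ;; improve regCeil regCeilM

/-- Copy the entry of the previous layer. -/
def copyEntry : RAMProg :=
  sub regU regT regLayer ;; load regBest arrVal regU ;; const regSize 0

/-- Compute the table entry at address `regT` in row `regJ` from the previous layer. -/
def computeEntry : RAMProg :=
  copyEntry ;; ifLt regZero regJ
    (sub regU regU regN1 ;; improveBoth) skip

/-- Store the computed table entry and move on to the next one. -/
def storeEntry : RAMProg :=
  store arrVal regT regBest ;; store arrSize regT regSize ;; add regT regT regOne ;;
    add regCell regCell regM

/-- Fill a row of the table. -/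
def fillRow : RAMProg :=
  copy regCell regC ;; forLt regOne regI regN1 (computeEntry ;; storeEntry)

/-- Fill a layer of the table. -/
def fillLayer : RAMProg :=
  load regC arrRank regP ;; forLt regOne regJ regK1 fillRow

/-- Fill the table. -/
def fillTable : RAMProg :=
  initTable ;; forLt regOne regP regM fillLayer

section Table

variable {n m k : ℕ} {s : RAMState} {T : ℕ → ℕ → ℕ → ℕ × ℕ} {w : ℕ → ℕ → ℕ}

theorem tableIndex_inj {c j i c' j' i' : ℕ} (hj : j ≤ k) (hi : i ≤ n) (hj' : j' ≤ k)
    (hi' : i' ≤ n) : tableIndex n k c j i = tableIndex n k c' j' i' ↔ c = c' ∧ j = j' ∧ i = i' := by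
  rw [tableIndex, tableIndex,
    mul_add_eq_mul_add_iff_of_lt (Nat.lt_succ_of_le hi) (Nat.lt_succ_of_le hi'),
    mul_add_eq_mul_add_iff_of_lt (Nat.lt_succ_of_le hj) (Nat.lt_succ_of_le hj'), and_assoc]

theorem tableIndex_lt_tableIndex {c j i c' : ℕ} (hc : c < c') (hj : j ≤ k) (hi : i ≤ n)
    (j' i' : ℕ) : tableIndex n k c j i < tableIndex n k c' j' i' := by
  have hrow : c * (k + 1) + j + 1 ≤ c' * (k + 1) + j' := by
    have := Nat.mul_le_mul_right (k + 1) hc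
    rw [Nat.succ_mul] at this
    omega
  have := Nat.mul_le_mul_right (n + 1) hrow
  rw [Nat.succ_mul] at this
  rw [tableIndex, tableIndex]
  omega

theorem tableIndex_succ_layer (c j i : ℕ) :
    tableIndex n k (c + 1) j i = tableIndex n k c j i + (k + 1) * (n + 1) := by
  rw [tableIndex, tableIndex]
  ring

theorem tableIndex_succ_row (c j i : ℕ) :
    tableIndex n k c (j + 1) i = tableIndex n k c j i + (n + 1) := by
  rw [tableIndex, tableIndex]
  ring

theorem haltsIn_initTable (hs : Params n m k s) :
    initTable.HaltsIn s ((k + 1) * (n + 1) * 3 + 4)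
      (FilledBelow n k (monroeTable w n m k) (tableIndex n k 1 0 0)) := by
  have hinf : (forLt regOne regX regLayer (store arrVal regX regInf)).HaltsIn s
      ((k + 1) * (n + 1) * 3 + 2) fun s' => ∀ t < (k + 1) * (n + 1), s'.arr arrVal t = m + 1 := by
    refine .forLt (B := 1) (fun i s' => ∀ t < i, s'.arr arrVal t = m + 1) hs.one_eq hs.layer_eq
      (by decide) (by decide) (by decide) (by simp) (by simp)
      fun i _ s' hf hi hval => .of_exec rfl le_rfl fun t ht => ?_
    have hinf' := (hs.frame hf (by decide)).inf_eq
    simp only [regX, regInf, arrVal] at hi hinf' hval ⊢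
    simp only [exec, RAMState.setArr_arr, if_true, hi, hinf', Function.update_apply]
    split_ifs with hti
    · rfl
    · exact hval t (by omega)
  have hindex : tableIndex n k 1 0 0 = (k + 1) * (n + 1) := by simp [tableIndex]
  refine hinf.seq fun s' hf hval => .of_exec rfl le_rfl ⟨?_, ?_, fun c j i _ _ ht => ?_⟩
  · have hlayer := (hs.frame hf (by decide)).layer_eq
    simp_all [exec]
  · have hzero := (hs.frame hf (by decide)).zero_eq
    rw [hindex]
    rintro (_ | c) j i - - ht
    · simp only [regZero, arrVal] at hzero hval ⊢
      simp only [exec, RAMState.setReg_arr, RAMState.setArr_arr, if_true, hzero,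
        Function.update_apply, monroeTable, blockTable, hval _ ht]
      simp [tableIndex]
    · rw [tableIndex_succ_layer] at ht
      omega
  · rw [tableIndex_succ_layer] at ht
    omega

theorem exec_blockValue {q qm z i r c b : ℕ} {D : ℕ → ℕ} (hqm : qm < 13) (hm : s.reg regM = m)
    (hz : s.reg q = z) (hzm : s.reg qm = z * m) (hpos : 0 < z) (hzi : z ≤ i) (hin : i ≤ n)
    (hcell : s.reg regCell = i * m + r) (hu : s.reg regU = b + i)
    (hD : ∀ i' < i, s.arr arrVal (b + i') = D i')
    (hw : ∀ v < n, s.arr arrPos (v * m + r) = w v c) :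
    ((blockValue q qm).exec s).reg regD = max (max (D (i - z)) (w (i - z) c)) (w (i - 1) c) := by
  have hz_le := Nat.mul_le_mul_right m hzi
  have hm_le := Nat.le_mul_of_pos_left m (hpos.trans_le hzi)
  have hval : s.arr arrVal (b + i - z) = D (i - z) := by
    rw [Nat.add_sub_assoc hzi, hD _ (by omega)]
  have hfirst : s.arr arrPos (i * m + r - z * m) = w (i - z) c := by
    rw [← hw _ (by omega), Nat.sub_mul, Nat.sub_add_comm hz_le]
  have hlast : s.arr arrPos (i * m + r - m) = w (i - 1) c := by
    rw [← hw _ (by omega), Nat.sub_one_mul, Nat.sub_add_comm hm_le]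
  simp only [regM, regCell, regU, arrVal, arrPos] at *
  have hqmD : qm ≠ 23 := by omega
  have hqmA : qm ≠ 24 := by omega
  simp [blockValue, exec, exec_maxInto, hm, hz, hzm, hcell, hu, hval, hfirst, hlast, hqmD, hqmA]

theorem exec_improve {q qm z i r c b : ℕ} {D : ℕ → ℕ} (hq : q < 13) (hqm : qm < 13)
    (hm : s.reg regM = m) (hz : s.reg q = z) (hzm : s.reg qm = z * m) (hpos : 0 < z)
    (hin : i ≤ n) (hi : s.reg regI = i) (hcell : s.reg regCell = i * m + r)
    (hu : s.reg regU = b + i) (hD : ∀ i' < i, s.arr arrVal (b + i') = D i')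
    (hw : ∀ v < n, s.arr arrPos (v * m + r) = w v c) :
    (((improve q qm).exec s).reg regBest, ((improve q qm).exec s).reg regSize) =
      tryBlock w D c i z (s.reg regBest, s.reg regSize) := by
  by_cases hzi : i < z
  · simp only [improve, exec, hi, hz, hzi, tryBlock, if_true]
  have hvalue := exec_blockValue hqm hm hz hzm hpos (not_lt.1 hzi) hin hcell hu hD hw
  have hframe : (blockValue q qm).Frame s ((blockValue q qm).exec s) := frame_exec rfl s
  have hbest := hframe.reg regBest (by simp [blockValue, maxInto, regWrites])
  have hsize := hframe.reg regSize (by simp [blockValue, maxInto, regWrites])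
  have hz' := (hframe.reg q (by simp [blockValue, maxInto, regWrites]; omega)).trans hz
  rw [improve, exec, hi, hz, if_neg hzi, exec, exec, hvalue, hbest, tryBlock, if_neg hzi]
  split_ifs with hlt
  · simp only [regBest, regSize, regD] at *
    have hqBest : q ≠ 21 := by omega
    simp [exec, hvalue, hz', hqBest]
  · rw [exec, hbest, hsize]

theorem exec_improveBoth {i r c b : ℕ} {D : ℕ → ℕ} (hs : Params n m k s) (hq : 0 < n / k)
    (hin : i ≤ n) (hi : s.reg regI = i) (hcell : s.reg regCell = i * m + r)
    (hu : s.reg regU = b + i) (hD : ∀ i' < i, s.arr arrVal (b + i') = D i')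
    (hw : ∀ v < n, s.arr arrPos (v * m + r) = w v c) :
    ((improveBoth.exec s).reg regBest, (improveBoth.exec s).reg regSize) =
      tryBlock w D c i (n ⌈/⌉ k)
        (tryBlock w D c i (n / k) (s.reg regBest, s.reg regSize)) := by
  have hceil : 0 < n ⌈/⌉ k := hq.trans_le (Nat.floorDiv_eq_div n k ▸ floorDiv_le_ceilDiv)
  have hf : (improve regFloor regFloorM).Frame s _ := frame_exec rfl s
  have hs' := hs.frame hf (by decide)
  rw [improveBoth, exec, ← exec_improve (by decide) (by decide) hs.m_eq hs.floor_eq hs.floorM_eq hq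
    hin hi hcell hu hD hw]
  refine exec_improve (by decide) (by decide) hs'.m_eq hs'.ceil_eq hs'.ceilM_eq hceil hin
    ((hf.reg _ (by decide)).trans hi) ((hf.reg _ (by decide)).trans hcell)
    ((hf.reg _ (by decide)).trans hu) ?_ ?_
  · simpa only [hf.arr arrVal (by decide)] using hD
  · simpa only [hf.arr arrPos (by decide)] using hw

theorem exec_copyEntry {c j i : ℕ} (hs : Params n m k s)
    (hnext : s.reg regT = tableIndex n k (c + 1) j i) :
    (copyEntry.exec s).reg regU = tableIndex n k c j i ∧
      (copyEntry.exec s).reg regBest = s.arr arrVal (tableIndex n k c j i) ∧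
        (copyEntry.exec s).reg regSize = 0 := by
  have hlayer := hs.layer_eq
  rw [tableIndex_succ_layer] at hnext
  simp only [regT, regLayer] at hnext hlayer
  simp [copyEntry, exec, hnext, hlayer]

theorem exec_computeEntry {c j i r : ℕ} (hs : Params n m k s) (hq : 0 < n / k)
    (hj : s.reg regJ = j) (hjk : j ≤ k) (hi : s.reg regI = i) (hin : i ≤ n)
    (hcell : s.reg regCell = i * m + r) (hw : ∀ v < n, s.arr arrPos (v * m + r) = w v c)
    (hT : FilledBelow n k (monroeTable w n m k) (tableIndex n k (c + 1) j i) s) :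
    ((computeEntry.exec s).reg regBest, (computeEntry.exec s).reg regSize) =
      monroeTable w n m k (c + 1) j i := by
  have hprev {j' i'} (hj' : j' ≤ j) (hi' : i' ≤ i) :
      s.arr arrVal (tableIndex n k c j' i') = (monroeTable w n m k c j' i').1 :=
    hT.val c j' i' (hj'.trans hjk) (hi'.trans hin)
      (tableIndex_lt_tableIndex c.lt_succ_self (hj'.trans hjk) (hi'.trans hin) j i)
  have hf₁ : copyEntry.Frame s (copyEntry.exec s) := frame_exec rfl s
  obtain ⟨hU₁, hbest₁, hsize₁⟩ := exec_copyEntry hs hT.next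
  rw [hprev le_rfl le_rfl] at hbest₁
  rw [computeEntry, exec, exec, (hs.frame hf₁ (by decide)).zero_eq,
    (hf₁.reg regJ (by decide)).trans hj]
  cases j with
  | zero => simp [exec, hbest₁, hsize₁, monroeTable, blockTable]
  | succ j =>
    have hf : (copyEntry ;; sub regU regU regN1).Frame s _ := hf₁.seq (frame_exec rfl _)
    rw [if_pos (Nat.succ_pos j), exec, exec_improveBoth (w := w) (r := r) (c := c)
      (b := tableIndex n k c j 0) (D := fun i' => (monroeTable w n m k c j i').1)
      (hs.frame hf (by decide)) hq hin ((hf.reg _ (by decide)).trans hi)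
      ((hf.reg _ (by decide)).trans hcell)]
    · simp only [exec, regU, regBest, regSize] at hbest₁ hsize₁ ⊢
      simp [hbest₁, hsize₁, monroeTable, blockTable]
    · have hn1 := (hs.frame hf₁ (by decide)).n1_eq
      rw [tableIndex_succ_row] at hU₁
      simp only [regU, regN1] at hU₁ hn1
      simp [exec, hU₁, hn1, tableIndex]
    · intro i' hi'
      rw [hf.arr arrVal (by decide)]
      exact hprev j.le_succ hi'.le
    · simpa only [hf.arr arrPos (by decide)] using hw

theorem FilledBelow.frame {p : RAMProg} {s' : RAMState} {t : ℕ} (h : FilledBelow n k T t s)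
    (hf : p.Frame s s') (hreg : regT ∉ p.regWrites) (hval : arrVal ∉ p.arrWrites)
    (hsize : arrSize ∉ p.arrWrites) : FilledBelow n k T t s' where
  next := (hf.reg _ hreg).trans h.next
  val := by simpa only [hf.arr _ hval] using h.val
  size := by simpa only [hf.arr _ hsize] using h.size

theorem FilledBelow.setReg {t x : ℕ} (h : FilledBelow n k T t s) (hx : regT ≠ x) (v : ℕ) :
    FilledBelow n k T t (s.setReg x v) :=
  h.frame (frame_exec (p := const x v) rfl s) (by simpa [regWrites] using hx)
    (by simp [arrWrites]) (by simp [arrWrites])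

theorem FilledBelow.exec_storeEntry {c j i : ℕ}
    (h : FilledBelow n k T (tableIndex n k (c + 1) j i) s) (hjk : j ≤ k) (hin : i ≤ n)
    (hone : s.reg regOne = 1) (hentry : (s.reg regBest, s.reg regSize) = T (c + 1) j i) :
    FilledBelow n k T (tableIndex n k (c + 1) j (i + 1)) (storeEntry.exec s) := by
  have hnext := h.next
  obtain ⟨hbest, hsize⟩ := Prod.ext_iff.1 hentry
  have hlt {t} (ht : t < tableIndex n k (c + 1) j (i + 1)) (hne : t ≠ tableIndex n k (c + 1) j i) :
      t < tableIndex n k (c + 1) j i := lt_of_le_of_ne (Nat.le_of_lt_succ ht) hne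
  simp only [regT, regOne, regBest, regSize] at hnext hone hbest hsize
  refine ⟨?_, fun c' j' i' hj' hi' ht => ?_, fun c' j' i' hj' hi' ht => ?_⟩
  · simp [storeEntry, exec, hnext, hone, tableIndex, add_assoc]
  · suffices Function.update (s.arr arrVal) (tableIndex n k (c + 1) j i) (T (c + 1) j i).1
        (tableIndex n k c' j' i') = (T c' j' i').1 by
      simpa [storeEntry, exec, hnext, hbest]
    by_cases heq : tableIndex n k c' j' i' = tableIndex n k (c + 1) j i
    · obtain ⟨rfl, rfl, rfl⟩ := (tableIndex_inj hj' hi' hjk hin).1 heq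
      rw [Function.update_self]
    · rw [Function.update_of_ne heq, h.val _ _ _ hj' hi' (hlt ht heq)]
  · suffices Function.update (s.arr arrSize) (tableIndex n k (c + 1) j i) (T (c + 1) j i).2
        (tableIndex n k (c' + 1) j' i') = (T (c' + 1) j' i').2 by
      simpa [storeEntry, exec, hnext, hsize]
    by_cases heq : tableIndex n k (c' + 1) j' i' = tableIndex n k (c + 1) j i
    · obtain ⟨hc, rfl, rfl⟩ := (tableIndex_inj hj' hi' hjk hin).1 heq
      rw [heq, hc, Function.update_self]
    · rw [Function.update_of_ne heq, h.size _ _ _ hj' hi' (hlt ht heq)]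

theorem haltsIn_fillRow {c j r : ℕ} (hs : Params n m k s) (hq : 0 < n / k)
    (hj : s.reg regJ = j) (hjk : j ≤ k) (hr : s.reg regC = r)
    (hw : ∀ v < n, s.arr arrPos (v * m + r) = w v c)
    (hT : FilledBelow n k (monroeTable w n m k) (tableIndex n k (c + 1) j 0) s) :
    fillRow.HaltsIn s ((n + 1) * 48 + 3)
      (FilledBelow n k (monroeTable w n m k) (tableIndex n k (c + 1) (j + 1) 0)) := by
  have hcopy : (copy regCell regC).HaltsIn s 1 fun s' => s'.reg regCell = 0 * m + r :=
    .of_exec rfl le_rfl (by simpa [exec] using hr)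
  refine HaltsIn.mono (hcopy.seq fun s₀ hf₀ hcell₀ => .forLt (N := n + 1) (B := 46) (fun i s' =>
    s'.reg regCell = i * m + r ∧
      FilledBelow n k (monroeTable w n m k) (tableIndex n k (c + 1) j i) s')
    (hs.frame hf₀ (by decide)).one_eq (hs.frame hf₀ (by decide)).n1_eq (by decide) (by decide)
    (by decide) (fun i s' v ⟨hcell, hT⟩ => ⟨by simpa using hcell, hT.setReg (by decide) v⟩)
    ⟨hcell₀, hT.frame hf₀ (by decide) (by decide) (by decide)⟩
    fun i hi s₁ hf₁ hi₁ ⟨hcell, hT⟩ => ?_) (by rw [add_comm]) fun s' _ h => ?_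
  · have hf := hf₀.seq hf₁
    have hs₁ := hs.frame hf (by decide)
    have hin := Nat.le_of_lt_succ hi
    have hcompute : computeEntry.HaltsIn s₁ 42 (· = computeEntry.exec s₁) :=
      .of_exec rfl (by decide) rfl
    refine hcompute.seq fun s₂ hf₂ hs₂ => .of_exec rfl le_rfl ⟨?_, ?_⟩
    · have hm := (hs₁.frame hf₂ (by decide)).m_eq
      have hcell₂ := (hf₂.reg _ (by decide)).trans hcell
      simp only [regCell, regM] at hcell₂ hm
      simp [storeEntry, exec, hcell₂, hm, Nat.succ_mul, add_right_comm]
    · refine (hT.frame hf₂ (by decide) (by decide) (by decide)).exec_storeEntry hjk hin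
        (hs₁.frame hf₂ (by decide)).one_eq ?_
      rw [hs₂]
      exact exec_computeEntry hs₁ hq ((hf.reg _ (by decide)).trans hj) hjk hi₁ hin hcell
        (by simpa only [hf.arr arrPos (by decide)] using hw) hT
  · rw [tableIndex_succ_row]
    exact h.2

theorem haltsIn_fillLayer {c : ℕ} (hs : Params n m k s) (hq : 0 < n / k) (hc : s.reg regP = c)
    (hw : ∀ v < n, s.arr arrPos (v * m + s.arr arrRank c) = w v c)
    (hT : FilledBelow n k (monroeTable w n m k) (tableIndex n k (c + 1) 0 0) s) :
    fillLayer.HaltsIn s ((k + 1) * ((n + 1) * 48 + 5) + 3)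
      (FilledBelow n k (monroeTable w n m k) (tableIndex n k (c + 2) 0 0)) := by
  have hload : (load regC arrRank regP).HaltsIn s 1 fun s' => s'.reg regC = s.arr arrRank c :=
    .of_exec rfl le_rfl (by simpa [exec] using congrArg (s.arr 0) hc)
  refine HaltsIn.mono (hload.seq fun s₀ hf₀ hr₀ => .forLt (N := k + 1) (B := (n + 1) * 48 + 3)
    (fun j => FilledBelow n k (monroeTable w n m k) (tableIndex n k (c + 1) j 0))
    (hs.frame hf₀ (by decide)).one_eq (hs.frame hf₀ (by decide)).k1_eq (by decide) (by decide)
    (by decide) (fun j s' v hT => hT.setReg (by decide) v)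
    (hT.frame hf₀ (by decide) (by decide) (by decide)) fun j hj s₁ hf₁ hj₁ hT => ?_)
    (by rw [add_comm]) fun s' _ hT => ?_
  · have hf := hf₀.seq hf₁
    exact haltsIn_fillRow (hs.frame hf (by decide)) hq hj₁ (Nat.le_of_lt_succ hj)
      ((hf₁.reg _ (by decide)).trans hr₀) (by simpa only [hf.arr arrPos (by decide)] using hw) hT
  · simpa [tableIndex, Nat.succ_mul, add_assoc] using hT

theorem haltsIn_fillTable (hs : Params n m k s) (hq : 0 < n / k)
    (hw : ∀ c < m, ∀ v < n, s.arr arrPos (v * m + s.arr arrRank c) = w v c) :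
    fillTable.HaltsIn s ((k + 1) * (n + 1) * 3 + 4 + (m * ((k + 1) * ((n + 1) * 48 + 5) + 5) + 2))
      (FilledBelow n k (monroeTable w n m k) (tableIndex n k (m + 1) 0 0)) := by
  refine (haltsIn_initTable hs).seq fun s₀ hf₀ hT₀ => .forLt
    (fun c => FilledBelow n k (monroeTable w n m k) (tableIndex n k (c + 1) 0 0))
    (hs.frame hf₀ (by decide)).one_eq (hs.frame hf₀ (by decide)).m_eq (by decide) (by decide)
    (by decide) (fun j s' v hT => hT.setReg (by decide) v) hT₀ fun c hc s₁ hf₁ hc₁ hT => ?_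
  have hf := hf₀.seq hf₁
  refine haltsIn_fillLayer (hs.frame hf (by decide)) hq hc₁ ?_ hT
  simpa only [hf.arr arrPos (by decide), hf.arr arrRank (by decide)] using hw c hc

end Table

end RAMProg

namespace RAMProg

/-! #### Reading off an assignment -/

/-- Move back from the table entry at address `regT` by the last block of a recorded solution, and
load the size of this block and its candidate. -/
def stepBack : RAMProg :=
  sub regP regP regOne ;; load regC arrRank regP ;; load regSize arrSize regT ;;
    sub regT regT regLayer ;; sub regT regT regSize ;;
      ifLt regZero regSize (sub regT regT regN1) skip ;; sub regI regI regSize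

/-- Assign candidate `regC` to the `regSize` voters from `regI` on. -/
def writeBlock : RAMProg :=
  forLt regOne regX regSize (add regU regI regX ;; store arrOut regU regC)

/-- Read off an assignment from the last entry of the table. -/
def readAssignment : RAMProg :=
  (copy regI regN ;; copy regP regM ;; sub regT regT regOne) ;;
    whileLt regZero regP (stepBack ;; writeBlock)

/-- The state of `readAssignment` when the blocks of the candidates in the places from `c` on have
been read off, where `f` lists the block sizes and `r` the candidates. -/
structure ReadFrom (n m k : ℕ) (f r : ℕ → ℕ) (c : ℕ) (s : RAMState) : Prop where
  place : s.reg regP = c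
  voter : s.reg regI = blockStart f c
  entry : s.reg regT = tableIndex n k c (blockCount f c) (blockStart f c)
  out : ∀ p < m, c ≤ p → ∀ v, blockStart f p ≤ v → v < blockStart f (p + 1) → s.arr arrOut v = r p

section ReadAssignment

variable {n m k : ℕ} {s : RAMState} {f : ℕ → ℕ} {w : ℕ → ℕ → ℕ}

theorem haltsIn_stepBack {c : ℕ} (hs : Params n m k s) (hp : s.reg regP = c + 1)
    (hi : s.reg regI = blockStart f (c + 1))
    (ht : s.reg regT = tableIndex n k (c + 1) (blockCount f (c + 1)) (blockStart f (c + 1)))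
    (hsize : s.arr arrSize (s.reg regT) = f c) :
    stepBack.HaltsIn s 9 fun s' => s'.reg regP = c ∧ s'.reg regC = s.arr arrRank c ∧
      s'.reg regSize = f c ∧ s'.reg regI = blockStart f c ∧
        s'.reg regT = tableIndex n k c (blockCount f c) (blockStart f c) := by
  have hone := hs.one_eq
  have hzero := hs.zero_eq
  have hn1 := hs.n1_eq
  have hlayer := hs.layer_eq
  have hindex : tableIndex n k (c + 1) (blockCount f (c + 1)) (blockStart f (c + 1)) =
      tableIndex n k c (blockCount f c) (blockStart f c) + (if 0 < f c then n + 1 else 0) + f c +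
        (k + 1) * (n + 1) := by
    rw [tableIndex_succ_layer, blockCount_succ, blockStart_succ]
    obtain hf | hf := (f c).eq_zero_or_pos
    · simp [hf]
    · rw [if_pos hf.ne', if_pos hf, tableIndex_succ_row, tableIndex, tableIndex]
      ring
  rw [ht, hindex] at hsize
  rw [hindex] at ht
  rw [blockStart_succ] at hi
  refine .of_exec rfl (by decide) ?_
  simp only [regP, regI, regT, regOne, regZero, regN1, regLayer, arrSize, arrRank] at *
  split_ifs at ht hsize with hf
  · simp [stepBack, exec, *]
  · rw [add_zero] at ht hsize
    simp [stepBack, exec, *]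

theorem haltsIn_writeBlock {b z r : ℕ} (hone : s.reg regOne = 1) (hi : s.reg regI = b)
    (hsize : s.reg regSize = z) (hc : s.reg regC = r) :
    writeBlock.HaltsIn s (z * 4 + 2) fun s' => ∀ v,
      s'.arr arrOut v = if b ≤ v ∧ v < b + z then r else s.arr arrOut v := by
  refine .forLt (B := 2)
    (fun i s' => ∀ v, s'.arr arrOut v = if b ≤ v ∧ v < b + i then r else s.arr arrOut v) hone hsize
    (by decide) (by decide) (by decide) (by simp) (fun v => by rw [if_neg (by omega)])
    fun i _ s' hf hx hout => .of_exec rfl le_rfl fun v => ?_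
  have hi' := (hf.reg regI (by decide)).trans hi
  have hc' := (hf.reg regC (by decide)).trans hc
  simp only [regI, regC, regX] at hi' hc' hx
  suffices Function.update (s'.arr arrOut) (b + i) r v =
      if b ≤ v ∧ v < b + (i + 1) then r else s.arr arrOut v by simpa [exec, hi', hc', hx]
  rw [Function.update_apply, hout]
  grind

theorem haltsIn_readBlock {r : ℕ → ℕ} {c : ℕ} (hs : Params n m k s) (hfn : blockStart f (c + 1) ≤ n)
    (hsize : s.arr arrSize (s.reg regT) = f c) (hr : s.arr arrRank c = r c)
    (h : ReadFrom n m k f r (c + 1) s) :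
    (stepBack ;; writeBlock).HaltsIn s (9 + (n * 4 + 2)) (ReadFrom n m k f r c) := by
  refine (haltsIn_stepBack hs h.place h.voter h.entry hsize).seq
    fun s₁ hf₁ ⟨hp₁, hc₁, hsize₁, hi₁, ht₁⟩ =>
      (haltsIn_writeBlock (hs.frame hf₁ (by decide)).one_eq hi₁ hsize₁ hc₁).mono ?_
        fun s₂ hf₂ hwrite => ⟨(hf₂.reg _ (by decide)).trans hp₁,
          (hf₂.reg _ (by decide)).trans hi₁, (hf₂.reg _ (by decide)).trans ht₁, ?_⟩
  · rw [blockStart_succ] at hfn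
    omega
  · intro p hp hcp v hpv hvp
    rw [hwrite, ← blockStart_succ]
    obtain rfl | hcp := hcp.eq_or_lt
    · rw [if_pos ⟨hpv, hvp⟩, hr]
    · rw [if_neg fun hv => hv.2.not_ge ((blockStart_mono f hcp).trans hpv), hf₁.arr _ (by decide)]
      exact h.out p hp hcp v hpv hvp

theorem haltsIn_readAssignment (hs : Params n m k s)
    (hT : FilledBelow n k (monroeTable w n m k) (tableIndex n k (m + 1) 0 0) s)
    (hf : IsRecorded w (m + 1) (n / k) (n ⌈/⌉ k) m f) (hcount : blockCount f m = k)
    (hlast : blockStart f m = n) :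
    readAssignment.HaltsIn s (3 + (m * (9 + (n * 4 + 2) + 1) + 1)) fun s' => ∀ p < m, ∀ v,
      blockStart f p ≤ v → v < blockStart f (p + 1) → s'.arr arrOut v = s.arr arrRank p := by
  have hbegin : (copy regI regN ;; copy regP regM ;; sub regT regT regOne).HaltsIn s 3
      (ReadFrom n m k f (s.arr arrRank) m) := by
    have hn := hs.n_eq
    have hm := hs.m_eq
    have hone := hs.one_eq
    have ht := hT.next
    have hindex : tableIndex n k (m + 1) 0 0 = tableIndex n k m k n + 1 := by
      rw [tableIndex, tableIndex]
      ring
    rw [hindex] at ht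
    simp only [regN, regM, regOne, regT] at hn hm hone ht
    refine .of_exec rfl le_rfl ⟨?_, ?_, ?_, fun p hp hmp => by omega⟩ <;>
      simp [exec, hn, hm, hone, ht, hcount, hlast]
  refine HaltsIn.mono (hbegin.seq fun s₀ hf₀ h₀ => .whileLt (B := 9 + (n * 4 + 2))
    (ReadFrom n m k f (s.arr arrRank)) h₀ (fun c hc s₁ hf₁ h => ⟨?_, ?_⟩) fun s₁ hf₁ h => ?_) le_rfl
    fun s' _ h p hp => h.out p hp p.zero_le
  · rw [h.place, (hs.frame (hf₀.seq hf₁) (by decide)).zero_eq]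
    exact c.succ_pos
  · have hf' := hf₀.seq hf₁
    have hj : blockCount f (c + 1) ≤ k := hcount ▸ Nat.count_monotone _ hc
    have hi : blockStart f (c + 1) ≤ n := hlast ▸ blockStart_mono f hc
    refine haltsIn_readBlock (hs.frame hf' (by decide)) hi ?_
      (congrFun (hf'.arr arrRank (by decide)) c) h
    rw [h.entry, hf c hc, hf'.arr arrSize (by decide)]
    exact hT.size c _ _ hj hi (tableIndex_lt_tableIndex (Nat.succ_lt_succ hc) hj hi 0 0)
  · rw [h.place, (hs.frame (hf₀.seq hf₁) (by decide)).zero_eq]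
    exact lt_irrefl 0

end ReadAssignment

end RAMProg

namespace RAMProg

/-! #### The algorithm -/

/-- Find an optimal Monroe assignment. -/
def findMonroe : RAMProg :=
  setup ;; fillPos ;; fillTable ;; readAssignment

section FindMonroe

variable {n m k : ℕ} {s : RAMState} {E : Election n m} {a : ℕ → ℕ}

theorem haltsIn_fillTable_readAssignment (hs : Params n m k s) (hE : E.SingleCrossing)
    (hN : E.Narcissistic) (hk : 1 ≤ k) (hkm : k ≤ m) (ha : MonotoneOn a (Set.Icc 1 m))
    (hrank : ∀ (v : Fin n) (r : Fin m), s.arr arrRank (v * m + r) = E.ranking v r)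
    (hpos : ∀ (v : Fin n) (c : Fin m), s.arr arrPos (v * m + c) = E.pos v c) :
    (fillTable ;; readAssignment).HaltsIn s
      ((k + 1) * (n + 1) * 3 + 4 + (m * ((k + 1) * ((n + 1) * 48 + 5) + 5) + 2) +
        (3 + (m * (9 + (n * 4 + 2) + 1) + 1)))
      fun s' => ∃ Φ : Fin n → Fin m,
        s'.HoldsAssignment Φ ∧ E.IsOptimalMonroe a k Φ ∧ HasContiguousBlocks Φ := by
  have hmn := hN.le
  have hn : 0 < n := hk.trans (hkm.trans hmn)
  let w v p := s.arr arrPos (v * m + s.arr arrRank p)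
  have hq : 0 < n / k := Nat.div_pos (hkm.trans hmn) hk
  have hσ (p : Fin m) : s.arr arrRank p = E.ranking ⟨0, hn⟩ p := by
    simpa using hrank ⟨0, hn⟩ p
  have hw (v : Fin n) (p : Fin m) : w v p = E.axisPos hn v p := by
    simp only [w, hσ, hpos]
    rfl
  obtain ⟨f, hf, hcount, hlast⟩ := exists_isRecorded_of_forall_le (w := w) hk hkm hmn
    (fun v hv p hp => (hw ⟨v, hv⟩ ⟨p, hp⟩).trans_le (E.pos_le _ _)) m.lt_succ_self
  refine (haltsIn_fillTable hs hq (w := w) fun c _ v _ => rfl).seq fun s₁ hf₁ hT =>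
    (haltsIn_readAssignment (hs.frame hf₁ (by decide)) hT hf hcount hlast).mono le_rfl
      fun s₂ _ hout => ?_
  have hout' (p : Fin m) (v : Fin n) (hpv : blockStart f p ≤ v) (hvp : v < blockStart f (p + 1)) :
      s₂.arr arrOut v = E.ranking ⟨0, hn⟩ p := by
    rw [hout p p.2 v hpv hvp, hf₁.arr arrRank (by decide), hσ]
  have hexists (v : Fin n) : ∃ c : Fin m, s₂.arr arrOut v = c := by
    obtain ⟨p, hp, hpv, hvp⟩ := exists_block_of_lt_blockStart (v.2.trans_eq hlast.symm)
    exact ⟨_, hout' ⟨p, hp⟩ v hpv hvp⟩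
  choose Φ hΦ using hexists
  have hblock : IsBlockAssignment (E.ranking ⟨0, hn⟩) f Φ := fun p v hpv hvp =>
    Fin.ext ((hΦ v).symm.trans (hout' p v hpv hvp))
  exact ⟨Φ, hΦ, isOptimalMonroe_of_isRecorded ha hE hN hk hkm hw hf hcount hlast hblock,
    hblock.hasContiguousBlocks hlast⟩

theorem findMonroe_steps_le (hk : 1 ≤ k) (hkm : k ≤ m) (hmn : m ≤ n) :
    n / k * 4 + (k + 1) * 3 + 18 + (n * (m * 7 + 5) + 3 +
      ((k + 1) * (n + 1) * 3 + 4 + (m * ((k + 1) * ((n + 1) * 48 + 5) + 5) + 2) +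
        (3 + (m * (9 + (n * 4 + 2) + 1) + 1)))) ≤ 300 * (n * m ^ 2 * k) := by
  have hdiv := Nat.div_le_self n k
  obtain ⟨k, rfl⟩ := Nat.exists_eq_add_of_le' hk
  obtain ⟨m, rfl⟩ := Nat.exists_eq_add_of_le' (hk.trans hkm)
  obtain ⟨n, rfl⟩ := Nat.exists_eq_add_of_le' (hk.trans (hkm.trans hmn))
  generalize (n + 1) / (k + 1) = q at *
  ring_nf at *
  omega

theorem FindsOptimalMonroe.mono {p : RAMProg} {B B' : ℕ} (h : p.FindsOptimalMonroe s B E a k)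
    (hB : B ≤ B') : p.FindsOptimalMonroe s B' E a k := by
  obtain ⟨t, s', Φ, hr, ht, h⟩ := h
  exact ⟨t, s', Φ, hr, ht.trans hB, h⟩

theorem findsOptimalMonroe_findMonroe (hE : E.SingleCrossing) (hN : E.Narcissistic) (hk : 1 ≤ k)
    (hkm : k ≤ m) (ha : MonotoneOn a (Set.Icc 1 m)) (hs : s.HoldsInput E k) :
    findMonroe.FindsOptimalMonroe s (300 * (n * m ^ 2 * k)) E a k := by
  obtain ⟨hn, hm, hsk, hrank⟩ := hs
  have h : findMonroe.HaltsIn s _ _ :=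
    (haltsIn_setup hk hn hm hsk).seq fun s₁ hf₁ hs₁ =>
      have hrank₁ (v : Fin n) (r : Fin m) : s₁.arr arrRank (v * m + r) = E.ranking v r := by
        rw [hf₁.arr arrRank (by decide), hrank]
      (haltsIn_fillPos hs₁ hrank₁).seq fun s₂ hf₂ hpos =>
        haltsIn_fillTable_readAssignment (hs₁.frame hf₂ (by decide)) hE hN hk hkm ha
          (fun v r => by rw [hf₂.arr arrRank (by decide), hrank₁]) hpos
  obtain ⟨t, s', hr, ht, Φ, hΦ⟩ := h
  exact ⟨t, s', Φ, hr, ht.trans (findMonroe_steps_le hk hkm hN.le), hΦ⟩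

end FindMonroe

end RAMProg

theorem theorem7_general :
    ∃ (Q : RAMProg) (K : ℕ), ∀ (n m k : ℕ) (E : Election n m) (a : ℕ → ℕ),
      MonotoneOn a (Set.Icc 1 m) → E.SingleCrossing → E.Narcissistic → 1 ≤ k → k ≤ m →
        ∀ s : RAMState, s.HoldsInput E k → Q.FindsOptimalMonroe s (K * (n * m ^ 2 * k)) E a k :=
  ⟨RAMProg.findMonroe, 300, fun _ _ _ _ _ ha hE hN hk hkm _ hs =>
    RAMProg.findsOptimalMonroe_findMonroe hE hN hk hkm ha hs⟩

theorem theorem7 :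
    (∃ (Q : RAMProg) (K : ℕ), ∀ (n m k : ℕ) (E : Election n m) (a : ℕ → ℕ),
      IsDissatisfaction m a → E.SingleCrossing → E.Narcissistic → 1 ≤ k → k ≤ m →
        ∀ s : RAMState, s.HoldsInput E k → s.HoldsTable m a →
          Q.FindsOptimalMonroe s (K * (n * m ^ 2 * k)) E a k) ∧
    (∀ α : ℕ → ℕ → ℕ, (∀ m : ℕ, 1 ≤ m → IsDissatisfaction m (α m)) →
      ∀ (P : RAMProg) (T : Polynomial ℕ), P.ComputesFamily α (fun m => T.eval m) →
        ∃ (Q : RAMProg) (K : ℕ), ∀ (n m k : ℕ) (E : Election n m),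
          E.SingleCrossing → E.Narcissistic → 1 ≤ k → k ≤ m →
            ∀ s : RAMState, s.HoldsInput E k →
              Q.FindsOptimalMonroe s (K * (n * m ^ 2 * k + m * T.eval m)) E (α m) k) := by
  obtain ⟨Q, K, hQ⟩ := theorem7_general
  exact ⟨⟨Q, K, fun n m k E a ha hE hN hk hkm s hs _ => hQ n m k E a ha.mono hE hN hk hkm s hs⟩,
    fun α hα _ T _ => ⟨Q, K, fun n m k E hE hN hk hkm s hs =>
      (hQ n m k E (α m) (hα m (hk.trans hkm)).mono hE hN hk hkm s hs).mono
        (Nat.mul_le_mul_left K (Nat.le_add_right _ (m * T.eval m)))⟩⟩
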